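/- Let $$a_1=-25,\quad a_2=-5,\quad a_3=-10,\quad a_4=-1,\quad c_1=-9,\quad c_2=15,$$ and put $$A(x)=a_1a_2a_3a_4\,(x-a_1)(x-a_2)(x-a_3)(x-a_4),$$ $$B(x)=a_1^2a_2^2\,(x-c_1)(x-c_2)(x-a_3)(x-a_4),$$ $$C(x)=a_1a_2c_1c_2\,(x-a_1)(x-a_2)(x-c_1)(x-c_2).$$ Let $\mathcal E$ be the curve $y^2=A(x)T^4+4B(x)T^2+4C(x)$ over $\mathbb Q(T)$. The seven points $$(-25,\,120000T),\ (-5,\,10000T),\ (-10,\,11250),\ (-1,\,28800),\ (-9,\,800T^2),\ (15,\,20000T^2),\ \left(\tfrac{65}{7},\,\tfrac{540000T^2-2880000}{49}\right)$$ lie on $\mathcal E$. Take the rational point $(-10,-11250)$ of $\mathcal E$ as origin. Put $u=x+10$, $v=y$, $q=-11250$, and write the equation of $\mathcal E$ as $v^2=au^4+bu^3+cu^2+du+q^2$ with $a,b,c,d\in\mathbb Q[T]$. The substitution $$X=\frac{2q(v+q)+du}{u^2},\qquad Y=\frac{4q^2(v+q)+2q(du+cu^2)-d^2u^2/(2q)}{u^3}$$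 transforms $\mathcal E$ into the cubic $$E:\ Y^2+\alpha_1XY+\alpha_3Y=X^3+\alpha_2X^2+\alpha_4X+\alpha_6,$$ $$\alpha_1=\frac dq,\quad \alpha_2=c-\frac{d^2}{4q^2},\quad \alpha_3=2qb,\quad \alpha_4=-4q^2a,\quad \alpha_6=\alpha_2\alpha_4,$$ where $(u,v)=(0,q)$ goes to the point at infinity and $(u,v)=(0,-q)$ goes to $(-\alpha_2,\alpha_1\alpha_2-\alpha_3)$. Then: 1. $E$ is an elliptic curve over $\mathbb Q(T)$, and its specialization $E_{20}$ at $T=20$ is an elliptic curve over $\mathbb Q$. 2. The images of the seven points on $E_{20}$ (same formulas with $T=20$) are linearly independent over $\mathbb Z$ in $E_{20}(\mathbb Q)$. The determinant of their height matrix is approximately $37472$; precisely, it differs from $37472$ by less than $1$. Here the height matrix has entries $\langle P_i,P_j\rangle=\tfrac12\left(\hat h(P_i+P_j)-\hat h(P_i)-\hat h(P_j)\right)$, where $\hat h(P)=\lim_{n\to\infty}4^{-n}h(2^nP)$ exists for all $P\in E_{20}(\mathbb Q)$, $h(P)=\log\max(|m|,n)$ if the $X$-coordinate of $P$ is $m/n$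 in lowest terms with $n>0$, and $h(O)=0$. 3. The images of the seven points in $E(\mathbb Q(T))$ are linearly independent over $\mathbb Z$. Hence $\operatorname{rank}E(\mathbb Q(T))\ge 7$. -/

import Mathlib

open Polynomial Filter Topology

namespace RankSeven

section Quartic

variable {K : Type*} [Field K]

/-- `A(x) = a₁a₂a₃a₄(x - a₁)(x - a₂)(x - a₃)(x - a₄)`. -/
noncomputable def polyA (a₁ a₂ a₃ a₄ : K) : K[X] :=
  C (a₁ * a₂ * a₃ * a₄) * ((X - C a₁) * (X - C a₂) * (X - C a₃) * (X - C a₄))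

/-- `B(x) = a₁²a₂²(x - c₁)(x - c₂)(x - a₃)(x - a₄)`. -/
noncomputable def polyB (a₁ a₂ a₃ a₄ c₁ c₂ : K) : K[X] :=
  C (a₁ ^ 2 * a₂ ^ 2) * ((X - C c₁) * (X - C c₂) * (X - C a₃) * (X - C a₄))

/-- `C(x) = a₁a₂c₁c₂(x - a₁)(x - a₂)(x - c₁)(x - c₂)`. -/
noncomputable def polyC (a₁ a₂ c₁ c₂ : K) : K[X] :=
  C (a₁ * a₂ * c₁ * c₂) * ((X - C a₁) * (X - C a₂) * (X - C c₁) * (X - C c₂))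

/-- `A(x) t⁴ + 4 B(x) t² + 4 C(x)`, a polynomial in `x`, for a parameter `t` in `K`. -/
noncomputable def quarticFamily (a₁ a₂ a₃ a₄ c₁ c₂ t : K) : K[X] :=
  polyA a₁ a₂ a₃ a₄ * C t ^ 4 + 4 * polyB a₁ a₂ a₃ a₄ c₁ c₂ * C t ^ 2 + 4 * polyC a₁ a₂ c₁ c₂

/-- The right-hand side of the curve `y² = A(x) t⁴ + 4 B(x) t² + 4 C(x)` for the parameters
`a₁ = -25, a₂ = -5, a₃ = -10, a₄ = -1, c₁ = -9, c₂ = 15`. The curve over `ℚ(T)` is the case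
`K = ℚ(T)`, `t = T`; its specialization at `T = t₀` is the case `K = ℚ`, `t = t₀`. -/
noncomputable def quartic (t : K) : K[X] :=
  quarticFamily (-25) (-5) (-10) (-1) (-9) 15 t

/-- The seven points `(x, y)`. -/
def points (t : K) : Fin 7 → K × K :=
  ![(-25, 120000 * t), (-5, 10000 * t), (-10, 11250), (-1, 28800), (-9, 800 * t ^ 2),
    (15, 20000 * t ^ 2), (65 / 7, (540000 * t ^ 2 - 2880000) / 49)]

/-! ### From a quartic with a rational point to a Weierstrass cubic

Let `(x₀, q)` with `q ≠ 0` lie on `y² = f(x)`, where `f` is a quartic. With `u = x - x₀` and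
`v = y` the curve reads `v² = a u⁴ + b u³ + c u² + d u + q²`. -/

/-- The Weierstrass cubic `Y² + a₁XY + a₃Y = X³ + a₂X² + a₄X + a₆` with
`a₁ = d/q`, `a₂ = c - d²/(4q²)`, `a₃ = 2qb`, `a₄ = -4q²a`, `a₆ = a₂a₄`. -/
noncomputable def cubicOfQuartic (f : K[X]) (x₀ q : K) : WeierstrassCurve K :=
  let a := (taylor x₀ f).coeff 4
  let b := (taylor x₀ f).coeff 3
  let c := (taylor x₀ f).coeff 2
  let d := (taylor x₀ f).coeff 1
  { a₁ := d / q
    a₂ := c - d ^ 2 / (4 * q ^ 2)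
    a₃ := 2 * q * b
    a₄ := -4 * q ^ 2 * a
    a₆ := (c - d ^ 2 / (4 * q ^ 2)) * (-4 * q ^ 2 * a) }

/-- `P` is the point of the Weierstrass cubic that corresponds to the point `(x, y)` of the
quartic curve `y² = f(x)`: `(x₀, q)` corresponds to the point at infinity, `(x₀, -q)` to
`(-a₂, a₁a₂ - a₃)`, and for `u = x - x₀ ≠ 0`, `v = y` the coordinates are
`X = (2q(v + q) + du)/u²`, `Y = (4q²(v + q) + 2q(du + cu²) - d²u²/(2q))/u³`. -/
def Corresponds (f : K[X]) (x₀ q x y : K) (P : (cubicOfQuartic f x₀ q).toAffine.Point) : Prop :=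
  let W := cubicOfQuartic f x₀ q
  let c := (taylor x₀ f).coeff 2
  let d := (taylor x₀ f).coeff 1
  let u := x - x₀
  (u = 0 ∧ y = q ∧ P = 0) ∨
  (u = 0 ∧ y = -q ∧ ∃ h, P = .some (-W.a₂) (W.a₁ * W.a₂ - W.a₃) h) ∨
  (u ≠ 0 ∧ ∃ h, P = .some
    ((2 * q * (y + q) + d * u) / u ^ 2)
    ((4 * q ^ 2 * (y + q) + 2 * q * (d * u + c * u ^ 2) - d ^ 2 * u ^ 2 / (2 * q)) / u ^ 3) h)

/-- The Weierstrass cubic of `y² = quartic t`, obtained from the rational point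
`(x₀, q) = (-10, -11250)`, which becomes the point at infinity. -/
noncomputable def cubic (t : K) : WeierstrassCurve K :=
  cubicOfQuartic (quartic t) (-10) (-11250)

/-- `P i` is the point of the Weierstrass cubic that corresponds to the `i`-th of the seven
points. -/
def AreTransformed (t : K) (P : Fin 7 → (cubic t).toAffine.Point) : Prop :=
  ∀ i, Corresponds (quartic t) (-10) (-11250) (points t i).1 (points t i).2 (P i)

end Quartic

section Height

variable {W : WeierstrassCurve ℚ}

/-- The naive height on `W(ℚ)`: `log max(|m|, n)` if the `x`-coordinate is `m / n` in lowest
terms, and `0` at infinity. -/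
noncomputable def naiveHeight : W.toAffine.Point → ℝ
  | .zero => 0
  | .some x _ _ => Height.logHeight₁ x

/-- `ĥ` is the canonical (Néron–Tate) height on `W(ℚ)`, in the normalization
`ĥ(P) = lim h(2ⁿP) / 4ⁿ` with `h` the naive height of the `x`-coordinate. -/
def IsCanonicalHeight (ĥ : W.toAffine.Point → ℝ) : Prop :=
  ∀ P, Tendsto (fun n : ℕ ↦ naiveHeight ((2 ^ n : ℕ) • P) / 4 ^ n) atTop (𝓝 (ĥ P))

/-- The height matrix `(⟨Pᵢ, Pⱼ⟩)`, where `⟨P, Q⟩ = (ĥ(P + Q) - ĥ(P) - ĥ(Q)) / 2`, so that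
`⟨P, P⟩ = ĥ(P)`. -/
noncomputable def heightMatrix (ĥ : W.toAffine.Point → ℝ) {n : ℕ}
    (P : Fin n → W.toAffine.Point) : Matrix (Fin n) (Fin n) ℝ :=
  Matrix.of fun i j ↦ (ĥ (P i + P j) - ĥ (P i) - ĥ (P j)) / 2

end Height

end RankSeven

/-! Independence comes from a `2`-descent carried out `p`-adically. If `θ ∈ ℚ_p` is a root of the
`2`-division polynomial `4X³ + b₂X² + 2b₄X + b₆`, then `P ↦ x(P) - θ` is a homomorphism to `ℚ_pˣ`
modulo squares (`descentClass_add`). When the values at the seven points are units, the Legendre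
symbols of their reductions turn a relation `∑ nᵢPᵢ = 0` into a linear condition on the `nᵢ` modulo
`2` (`even_of_relation`). Seven pairs `(p, θ mod p)` give seven independent conditions, so every
`nᵢ` is even. Modulo `17` the `2`-division polynomial has no root, so there is no `2`-torsion; the
relation can be halved again and again, hence is trivial.

The argument uses only `t ≡ 20` in `ℤ_p`. It therefore covers `ℚ` with `t = 20`, and also `ℚ(T)`,
embedded in `ℚ_p` by sending `T` to a transcendental number congruent to `20`. No specialization
theorem is needed.

For the determinant, `ξ = (x - 8834705000) / 40000` passes to the smaller model `η² = ξ³ + ξ² -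
200848453433ξ + 25153088320336263`. Bezout identities for the duplication forms bound both the
cancellation and the height change under doubling, so `h(2ⁿP) / 4ⁿ` converges to `ĥ(P)` with
explicit error. For `n = 30` the exact coordinates of `2ⁿP` are far too long to write down.
`heightBits` instead tracks residues modulo powers of a quarter of the discriminant, which determine
each cancelled gcd, and leading digits with an error bound, which determine the size
(`heightBits_spec`). The pairings are then known so precisely that a crude perturbation bound for
determinants suffices. -/

namespace RankSeven

/-! ### Explicit equations for the cubic and the seven points. -/

section Explicit

variable {K : Type*} [Field K]

/-- The Taylor expansion of the quartic at `x = -10`. -/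
lemma taylor_quartic (t : K) :
    taylor (-10) (quartic t) =
      C (-67500 + 62500 * t ^ 2 + 1250 * t ^ 4) * X ^ 4 +
      C (1080000 - 2187500 * t ^ 2 + 1250 * t ^ 4) * X ^ 3 +
      C (20925000 + 16187500 * t ^ 2 - 206250 * t ^ 4) * X ^ 2 +
      C (-148500000 - 14062500 * t ^ 2 + 843750 * t ^ 4) * X + C 126562500 := by
  simp only [quartic, quarticFamily, polyA, polyB, polyC, taylor_apply, add_comp,
    Polynomial.mul_comp, pow_comp, sub_comp, X_comp, C_comp, ofNat_comp]
  simp only [map_add, map_sub, map_neg, map_mul, map_pow, map_ofNat, map_one]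
  ring

lemma taylor_quartic_coeff (t : K) :
    (taylor (-10) (quartic t)).coeff 4 = -67500 + 62500 * t ^ 2 + 1250 * t ^ 4 ∧
    (taylor (-10) (quartic t)).coeff 3 = 1080000 - 2187500 * t ^ 2 + 1250 * t ^ 4 ∧
    (taylor (-10) (quartic t)).coeff 2 = 20925000 + 16187500 * t ^ 2 - 206250 * t ^ 4 ∧
    (taylor (-10) (quartic t)).coeff 1 = -148500000 - 14062500 * t ^ 2 + 843750 * t ^ 4 := by
  rw [taylor_quartic]
  refine ⟨?_, ?_, ?_, ?_⟩ <;>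
  simp only [coeff_add, coeff_C_mul, coeff_X_pow, coeff_X, coeff_C] <;> norm_num

variable [CharZero K]

lemma cubic_eq (t : K) : cubic t =
    { a₁ := 13200 + 1250 * t ^ 2 - 75 * t ^ 4
      a₂ := -22635000 + 7937500 * t ^ 2 - 101875 * t ^ 4 + 46875 * t ^ 6 - 5625 / 4 * t ^ 8
      a₃ := -24300000000 + 49218750000 * t ^ 2 - 28125000 * t ^ 4
      a₄ := 34171875000000 - 31640625000000 * t ^ 2 - 632812500000 * t ^ 4
      a₆ := (-22635000 + 7937500 * t ^ 2 - 101875 * t ^ 4 + 46875 * t ^ 6 - 5625 / 4 * t ^ 8) *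
        (34171875000000 - 31640625000000 * t ^ 2 - 632812500000 * t ^ 4) } := by
  obtain ⟨h4, h3, h2, h1⟩ := taylor_quartic_coeff t
  simp only [cubic, cubicOfQuartic, h4, h3, h2, h1, WeierstrassCurve.mk.injEq]
  refine ⟨?_, ?_, ?_, ?_, ?_⟩ <;> ring

/-- The `X`-coordinates of the seven transformed points. -/
def pointX (t : K) : Fin 7 → K :=
  ![11025000 - 12000000 * t + 937500 * t ^ 2 - 56250 * t ^ 4,
    -19575000 - 9000000 * t - 2812500 * t ^ 2 + 168750 * t ^ 4,
    22635000 - 7937500 * t ^ 2 + 101875 * t ^ 4 - 46875 * t ^ 6 + 5625 / 4 * t ^ 8,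
    -21375000 - 1562500 * t ^ 2 + 93750 * t ^ 4,
    104625000 - 32062500 * t ^ 2 + 843750 * t ^ 4,
    -5535000 - 1282500 * t ^ 2 + 33750 * t ^ 4,
    -(31175000 / 9) - 4187500 / 3 * t ^ 2 + 43750 * t ^ 4]

/-- The `Y`-coordinates of the seven transformed points. -/
def pointY (t : K) : Fin 7 → K :=
  ![-17415000000 - 18000000000 * t + 13312500000 * t ^ 2 - 237187500 * t ^ 4 +
      70312500 * t ^ 6 - 2109375 * t ^ 8,
    189945000000 + 40500000000 * t - 23062500000 * t ^ 2 - 300937500 * t ^ 4 -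
      210937500 * t ^ 6 + 6328125 * t ^ 8,
    -274482000000 + 27262500000 * t ^ 2 + 10302875000 * t ^ 4 - 103906250 * t ^ 6 +
      47671875 * t ^ 8 - 10546875 / 2 * t ^ 10 + 421875 / 4 * t ^ 12,
    110025000000 - 15937500000 * t ^ 2 + 20312500 * t ^ 4 - 117187500 * t ^ 6 + 3515625 * t ^ 8,
    -1844775000000 + 542812500000 * t ^ 2 - 16692187500 * t ^ 4 - 1054687500 * t ^ 6 +
      31640625 * t ^ 8,
    25353000000 - 5989500000 * t ^ 2 + 61312500 * t ^ 4 - 42187500 * t ^ 6 + 1265625 * t ^ 8,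
    822115000000 / 27 - 68687500000 / 9 * t ^ 2 + 67812500 * t ^ 4 - 54687500 * t ^ 6 +
      1640625 * t ^ 8]

lemma equation_point (t : K) (i : Fin 7) :
    (cubic t).toAffine.Equation (pointX t i) (pointY t i) := by
  rw [WeierstrassCurve.Affine.equation_iff, cubic_eq]
  fin_cases i <;> simp [pointX, pointY] <;> ring

lemma point_mem_quartic (t : K) (i : Fin 7) :
    (points t i).2 ^ 2 = (quartic t).eval (points t i).1 := by
  fin_cases i <;>
  simp [points, quartic, quarticFamily, polyA, polyB, polyC] <;> ring

lemma exists_areTransformed (t : K) [(cubic t).IsElliptic] :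
    ∃ P : Fin 7 → (cubic t).toAffine.Point, AreTransformed t P ∧
      ∀ i, ∃ h, P i = .some (pointX t i) (pointY t i) h := by
  refine ⟨fun i ↦ .some _ _
    (WeierstrassCurve.Affine.equation_iff_nonsingular.mp (equation_point t i)),
    fun i ↦ ?_, fun i ↦ ⟨_, rfl⟩⟩
  obtain ⟨h4, h3, h2, h1⟩ := taylor_quartic_coeff t
  -- This is the point `(-10, 11250) = (x₀, -q)`, the only one with `u = 0`; its image is prescribed
  -- separately.
  by_cases hi : i = 2
  · subst hi
    refine .inr (.inl ⟨by simp [points], by simp [points], ?_⟩)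
    have hX : pointX t 2 = -(cubic t).a₂ := by rw [cubic_eq]; simp [pointX]; ring
    have hY : pointY t 2 = (cubic t).a₁ * (cubic t).a₂ - (cubic t).a₃ := by
      rw [cubic_eq]; simp [pointY]; ring
    have key : ∀ x y (h : (cubic t).toAffine.Nonsingular x y) x' y', x = x' → y = y' →
        ∃ h' : (cubic t).toAffine.Nonsingular x' y',
          WeierstrassCurve.Affine.Point.some x y h = .some x' y' h' := by
      rintro x y h _ _ rfl rfl
      exact ⟨h, rfl⟩
    exact key _ _ _ _ _ hX hY
  · have key : ∀ x y (h : (cubic t).toAffine.Nonsingular x y) x' y', x = x' → y = y' →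
        ∃ h' : (cubic t).toAffine.Nonsingular x' y',
          WeierstrassCurve.Affine.Point.some x y h = .some x' y' h' := by
      rintro x y h _ _ rfl rfl
      exact ⟨h, rfl⟩
    refine .inr (.inr ⟨?_, key _ _ _ _ _ ?_ ?_⟩)
    · fin_cases i <;> simp [points] at hi ⊢ <;> norm_num
    · rw [h1]
      fin_cases i <;> simp [points, pointX] at hi ⊢ <;> ring
    · rw [h1, h2]
      fin_cases i <;> simp [points, pointY] at hi ⊢ <;> ring

end Explicit

/-! ### Integral forms of the invariants and coordinates, which can be reduced modulo `p`. -/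

section Integral

variable {R : Type*} [CommRing R]

/-- The invariant `b₂` of the cubic, over any ring. -/
def invB₂ (t : R) : R := 83700000 + 64750000 * t ^ 2 - 825000 * t ^ 4

/-- The invariant `b₄` of the cubic, over any ring. -/
def invB₄ (t : R) : R :=
  -252416250000000 + 556031250000000 * t ^ 2 + 61709062500000 * t ^ 4 - 3726562500000 * t ^ 6 +
    2109375000 * t ^ 8

/-- The invariant `b₆` of the cubic, over any ring. -/
def invB₆ (t : R) : R :=
  -2503431562500000000000 + 1557667968750000000000 * t ^ 2 + 1462632187500000000000 * t ^ 4 -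
    3559570312500000000 * t ^ 6 - 5866171875000000000 * t ^ 8 + 59326171875000000 * t ^ 10 +
    3559570312500000 * t ^ 12

/-- `36` times the `X`-coordinates of the seven transformed points, over any ring. -/
def scaledX (t : R) : Fin 7 → R :=
  ![396900000 - 432000000 * t + 33750000 * t ^ 2 - 2025000 * t ^ 4,
    -704700000 - 324000000 * t - 101250000 * t ^ 2 + 6075000 * t ^ 4,
    814860000 - 285750000 * t ^ 2 + 3667500 * t ^ 4 - 1687500 * t ^ 6 + 50625 * t ^ 8,
    -769500000 - 56250000 * t ^ 2 + 3375000 * t ^ 4,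
    3766500000 - 1154250000 * t ^ 2 + 30375000 * t ^ 4,
    -199260000 - 46170000 * t ^ 2 + 1215000 * t ^ 4,
    -124700000 - 50250000 * t ^ 2 + 1575000 * t ^ 4]

variable {S : Type*} [CommRing S] (φ : R →+* S)

lemma map_invB₂ (t : R) : φ (invB₂ t) = invB₂ (φ t) := by
  simp only [invB₂, map_add, map_sub, map_mul, map_pow, map_ofNat]

lemma map_invB₄ (t : R) : φ (invB₄ t) = invB₄ (φ t) := by
  simp only [invB₄, map_add, map_sub, map_neg, map_mul, map_pow, map_ofNat]

lemma map_invB₆ (t : R) : φ (invB₆ t) = invB₆ (φ t) := by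
  simp only [invB₆, map_add, map_sub, map_neg, map_mul, map_pow, map_ofNat]

lemma map_scaledX (t : R) (i : Fin 7) : φ (scaledX t i) = scaledX (φ t) i := by
  fin_cases i <;> simp [scaledX] <;> simp only [map_ofNat]

end Integral

section Explicit

variable {K : Type*} [Field K] [CharZero K]

lemma cubic_b₂ (t : K) : (cubic t).b₂ = invB₂ t := by
  rw [cubic_eq, WeierstrassCurve.b₂, invB₂]; ring

lemma cubic_b₄ (t : K) : (cubic t).b₄ = invB₄ t := by
  rw [cubic_eq, WeierstrassCurve.b₄, invB₄]; ring

lemma cubic_b₆ (t : K) : (cubic t).b₆ = invB₆ t := by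
  rw [cubic_eq, WeierstrassCurve.b₆, invB₆]; ring

lemma scaledX_eq (t : K) (i : Fin 7) : scaledX t i = 36 * pointX t i := by
  fin_cases i <;> simp [scaledX, pointX] <;> ring

/-- The discriminant in terms of `b₂`, `b₄`, `b₆`, multiplied by `4`. -/
lemma four_mul_cubic_Δ (t : K) : 4 * (cubic t).Δ =
    -invB₂ t ^ 2 * (invB₂ t * invB₆ t - invB₄ t ^ 2) - 32 * invB₄ t ^ 3 - 108 * invB₆ t ^ 2 +
      36 * invB₂ t * invB₄ t * invB₆ t := by
  rw [WeierstrassCurve.Δ, ← cubic_b₂, ← cubic_b₄, ← cubic_b₆]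
  linear_combination (-(cubic t).b₂ ^ 2) * (cubic t).b_relation

end Explicit

/-! ### The `2`-descent homomorphism. -/

section Descent

open WeierstrassCurve.Affine

variable {K F : Type*} [Field K] [Field F] (W : WeierstrassCurve K) (φ : K →+* F) (θ : F)

/-- `θ` is the `x`-coordinate of a point of order two over `F`. -/
def IsTwoTorsionX : Prop :=
  4 * θ ^ 3 + φ W.b₂ * θ ^ 2 + 2 * φ W.b₄ * θ + φ W.b₆ = 0

/-- The units of a field modulo squares. -/
def UnitsModSquares (F : Type*) [Field F] : Type _ :=
  Fˣ ⧸ (powMonoidHom 2 : Fˣ →* Fˣ).range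

noncomputable instance (F : Type*) [Field F] : CommGroup (UnitsModSquares F) :=
  inferInstanceAs (CommGroup (Fˣ ⧸ (powMonoidHom 2 : Fˣ →* Fˣ).range))

/-- The class of a unit modulo squares. -/
noncomputable def squareClass (F : Type*) [Field F] : Fˣ →* UnitsModSquares F :=
  QuotientGroup.mk' _

lemma squareClass_eq_one {u : Fˣ} : squareClass F u = 1 ↔ ∃ s : Fˣ, s ^ 2 = u :=
  QuotientGroup.eq_one_iff _

lemma squareClass_mul_self (u : Fˣ) : squareClass F u * squareClass F u = 1 := by
  rw [← map_mul, squareClass_eq_one]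
  exact ⟨u, sq u⟩

/-- The class of `x - θ` modulo squares, for a point with `x`-coordinate `x`. -/
noncomputable def descentClass : W.toAffine.Point → UnitsModSquares F
  | .zero => 1
  | .some x _ _ => open Classical in
    if h : φ x - θ = 0 then 1 else squareClass F (Units.mk0 _ h)

variable {W φ θ}

lemma descentClass_some {x y : K} {h : W.toAffine.Nonsingular x y} (hx : φ x - θ ≠ 0) :
    descentClass W φ θ (.some x y h) = squareClass F (Units.mk0 _ hx) := by
  simp [descentClass, hx]

variable [DecidableEq K]

/-- The product of the values `xᵢ - θ` at three collinear points is a square. -/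
lemma four_mul_prod_eq_sq (hθ : IsTwoTorsionX W φ θ) {x₁ x₂ y₁ y₂ : K}
    (h₁ : W.toAffine.Equation x₁ y₁) (h₂ : W.toAffine.Equation x₂ y₂)
    (hxy : ¬(x₁ = x₂ ∧ y₁ = W.toAffine.negY x₂ y₂)) :
    ∃ s : F, 4 * ((φ x₁ - θ) * (φ x₂ - θ) *
      (φ (W.toAffine.addX x₁ x₂ (W.toAffine.slope x₁ x₂ y₁ y₂)) - θ)) = s ^ 2 := by
  set ℓ := W.toAffine.slope x₁ x₂ y₁ y₂
  have key := congrArg (Polynomial.eval₂ φ θ) (addPolynomial_slope h₁ h₂ hxy)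
  rw [addPolynomial_eq] at key
  simp only [Cubic.toPoly, eval₂_neg, eval₂_add, eval₂_mul, eval₂_sub, eval₂_C, eval₂_X, eval₂_pow,
    eval₂_one, eval₂_ofNat, map_one, map_sub, map_add, map_mul, map_neg, map_pow, map_ofNat] at key
  -- With `L` the line through the points, `key` says that the Weierstrass equation at `(θ, L(θ))`
  -- has value `∏ (xᵢ - θ)`. Completing the square, four times this value is `(2L(θ) + a₁θ + a₃)²`
  -- minus the `2`-division polynomial at `θ`, which vanishes.
  refine ⟨2 * (φ ℓ * (θ - φ x₁) + φ y₁) + φ W.a₁ * θ + φ W.a₃, ?_⟩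
  unfold IsTwoTorsionX at hθ
  simp only [WeierstrassCurve.b₂, WeierstrassCurve.b₄, WeierstrassCurve.b₆, map_add, map_mul,
    map_pow, map_ofNat] at hθ
  linear_combination (-4) * key - hθ

/-- Away from `2`, `P ↦ x(P) - θ` is a homomorphism to `Fˣ` modulo squares, as long as `θ` is not
the `x`-coordinate of a `K`-rational point. -/
lemma descentClass_add (h2 : (2 : F) ≠ 0) (hθ : IsTwoTorsionX W φ θ)
    (hne : ∀ x y, W.toAffine.Equation x y → φ x - θ ≠ 0) (P Q : W.toAffine.Point) :
    descentClass W φ θ (P + Q) = descentClass W φ θ P * descentClass W φ θ Q := by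
  rcases P with _ | ⟨x₁, y₁, h₁⟩
  · rw [← Point.zero_def, zero_add]
    exact (one_mul (M := UnitsModSquares F) _).symm
  rcases Q with _ | ⟨x₂, y₂, h₂⟩
  · rw [← Point.zero_def, add_zero]
    exact (mul_one (M := UnitsModSquares F) _).symm
  by_cases hxy : x₁ = x₂ ∧ y₁ = W.toAffine.negY x₂ y₂
  · rw [Point.add_of_Y_eq hxy.1 hxy.2]
    obtain ⟨rfl, -⟩ := hxy
    rw [descentClass_some (hne _ _ h₁.1), descentClass_some (hne _ _ h₂.1),
      squareClass_mul_self]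
    rfl
  · rw [Point.add_some hxy]
    have h₃ := nonsingular_add h₁ h₂ hxy
    obtain ⟨s, hs⟩ := four_mul_prod_eq_sq hθ h₁.1 h₂.1 hxy
    -- Every class is its own inverse, so the claim is that the product of all three classes is
    -- trivial.
    rw [descentClass_some (hne _ _ h₁.1), descentClass_some (hne _ _ h₂.1),
      descentClass_some (hne _ _ h₃.1), ← mul_left_inj, squareClass_mul_self, eq_comm,
      ← map_mul, ← map_mul, squareClass_eq_one]
    have hs0 : s ≠ 0 := by
      rintro rfl
      have h4 : (4 : F) ≠ 0 := by
        have : (4 : F) = 2 * 2 := by norm_num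
        rw [this]; exact mul_ne_zero h2 h2
      have := mul_ne_zero h4 (mul_ne_zero (mul_ne_zero (hne _ _ h₁.1) (hne _ _ h₂.1))
        (hne _ _ h₃.1))
      exact this (by rw [hs]; ring)
    refine ⟨Units.mk0 (s / 2) (div_ne_zero hs0 h2), Units.ext ?_⟩
    simp only [Units.val_pow_eq_pow_val, Units.val_mk0, Units.val_mul]
    field_simp
    linear_combination -hs

/-- The descent map as a homomorphism. -/
noncomputable def descentHom (h2 : (2 : F) ≠ 0) (hθ : IsTwoTorsionX W φ θ)
    (hne : ∀ x y, W.toAffine.Equation x y → φ x - θ ≠ 0) :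
    W.toAffine.Point →+ Additive (UnitsModSquares F) where
  toFun P := .ofMul (descentClass W φ θ P)
  map_zero' := rfl
  map_add' P Q := congrArg Additive.ofMul (descentClass_add h2 hθ hne P Q)

/-- A relation among points makes a product of powers of the `x - θ` a square. -/
lemma exists_sq_eq_prod_zpow (h2 : (2 : F) ≠ 0) (hθ : IsTwoTorsionX W φ θ)
    (hne : ∀ x y, W.toAffine.Equation x y → φ x - θ ≠ 0) {ι : Type*} [Fintype ι]
    {P : ι → W.toAffine.Point} {x y : ι → K} (hP : ∀ i, ∃ h, P i = .some (x i) (y i) h)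
    {n : ι → ℤ} (hn : ∑ i, n i • P i = 0) :
    ∃ s : F, s ^ 2 = ∏ i, (φ (x i) - θ) ^ n i := by
  have h := congrArg (descentHom h2 hθ hne) hn
  have hx : ∀ i, φ (x i) - θ ≠ 0 := fun i ↦ by
    obtain ⟨h, -⟩ := hP i
    exact hne _ _ h.1
  have hPi : ∀ i, descentHom h2 hθ hne (P i) =
      .ofMul (squareClass F (Units.mk0 _ (hx i))) := fun i ↦ by
    obtain ⟨h, h'⟩ := hP i
    rw [h']
    exact congrArg Additive.ofMul (descentClass_some (hx i))
  simp only [map_sum, map_zsmul, hPi, map_zero] at h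
  have h' : squareClass F (∏ i, Units.mk0 _ (hx i) ^ n i) = 1 := by
    have := congrArg Additive.toMul h
    simp only [toMul_sum, toMul_zsmul, toMul_ofMul, toMul_zero] at this
    simpa only [map_prod, map_zpow] using this
  obtain ⟨s, hs⟩ := squareClass_eq_one.mp h'
  refine ⟨s, ?_⟩
  rw [← Units.val_pow_eq_pow_val, hs, Units.coe_prod]
  simp

end Descent

/-! ### Infinite descent on relations. -/

section Independence

/-- In a group without `2`-torsion, elements are independent if all coefficients of every relation
are even. -/
lemma linearIndependent_of_even {A : Type*} [AddCommGroup A] {ι : Type*} [Fintype ι] {P : ι → A}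
    (h2 : ∀ a : A, 2 • a = 0 → a = 0)
    (heven : ∀ n : ι → ℤ, ∑ i, n i • P i = 0 → ∀ i, Even (n i)) : LinearIndependent ℤ P := by
  -- Half of a relation is again a relation, since there is no `2`-torsion; hence all powers of `2`
  -- divide the coefficients.
  have hpow : ∀ (k : ℕ) (n : ι → ℤ), ∑ i, n i • P i = 0 → ∀ i, (2 : ℤ) ^ k ∣ n i := by
    intro k
    induction k with
    | zero => simp
    | succ k ih =>
      intro n hn
      choose m hm using heven n hn
      have hm0 : ∑ i, m i • P i = 0 := by
        apply h2
        rw [Finset.smul_sum, ← hn]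
        refine Finset.sum_congr rfl fun i _ ↦ ?_
        rw [hm i, add_smul, two_smul]
      intro i
      obtain ⟨c, hc⟩ := ih m hm0 i
      exact ⟨c, by rw [hm i, hc]; ring⟩
  rw [Fintype.linearIndependent_iff]
  intro n hn i
  by_contra hne
  have h1 := Int.le_of_dvd (abs_pos.mpr hne) ((dvd_abs _ _).mpr (hpow (n i).natAbs n hn i))
  rw [Int.abs_eq_natAbs] at h1
  have h3 : (n i).natAbs < 2 ^ (n i).natAbs := Nat.lt_two_pow_self
  zify at h3
  push_cast at h1
  omega

end Independence

/-! ### Hensel lifting, Legendre symbols and `p`-adic embeddings. -/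

section Padic

variable {p : ℕ} [Fact p.Prime]

lemma norm_eq_one_of_toZMod_ne_zero {x : ℤ_[p]} (hx : PadicInt.toZMod x ≠ 0) : ‖x‖ = 1 := by
  by_contra h
  refine hx ?_
  rw [← RingHom.mem_ker, PadicInt.ker_toZMod]
  exact PadicInt.mem_nonunits.mpr (lt_of_le_of_ne (PadicInt.norm_le_one x) h)

lemma norm_lt_one_of_toZMod_eq_zero {x : ℤ_[p]} (hx : PadicInt.toZMod x = 0) : ‖x‖ < 1 := by
  rw [← RingHom.mem_ker, PadicInt.ker_toZMod] at hx
  exact PadicInt.mem_nonunits.mp hx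

/-- Simple roots of `4X³ + b₂X² + 2b₄X + b₆` modulo `p` lift to `ℤ_p`. -/
lemma exists_root_lift (b₂ b₄ b₆ : ℤ_[p]) (θ₀ : ZMod p)
    (h0 : 4 * θ₀ ^ 3 + PadicInt.toZMod b₂ * θ₀ ^ 2 + 2 * PadicInt.toZMod b₄ * θ₀ +
      PadicInt.toZMod b₆ = 0)
    (h1 : 12 * θ₀ ^ 2 + 2 * PadicInt.toZMod b₂ * θ₀ + 2 * PadicInt.toZMod b₄ ≠ 0) :
    ∃ θ : ℤ_[p], 4 * θ ^ 3 + b₂ * θ ^ 2 + 2 * b₄ * θ + b₆ = 0 ∧ PadicInt.toZMod θ = θ₀ := by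
  obtain ⟨a, rfl⟩ := ZMod.ringHom_surjective (PadicInt.toZMod (p := p)) θ₀
  let f : ℤ_[p][X] := 4 * X ^ 3 + C b₂ * X ^ 2 + 2 * C b₄ * X + C b₆
  have hf (z : ℤ_[p]) : f.aeval z = 4 * z ^ 3 + b₂ * z ^ 2 + 2 * b₄ * z + b₆ := by
    simp [f]
  have hf' (z : ℤ_[p]) : f.derivative.aeval z = 12 * z ^ 2 + 2 * b₂ * z + 2 * b₄ := by
    simp [f]; ring
  have hn1 : ‖f.derivative.aeval a‖ = 1 := by
    apply norm_eq_one_of_toZMod_ne_zero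
    rw [hf']
    simpa only [map_add, map_mul, map_pow, map_ofNat] using h1
  have hn0 : ‖f.aeval a‖ < 1 := by
    apply norm_lt_one_of_toZMod_eq_zero
    rw [hf]
    simpa only [map_add, map_mul, map_pow, map_ofNat] using h0
  obtain ⟨z, hz, hza, -⟩ := hensels_lemma (F := f) (a := a) (by rw [hn1]; simpa using hn0)
  refine ⟨z, by rw [← hf, hz], ?_⟩
  rw [← sub_eq_zero, ← map_sub]
  rw [hn1] at hza
  rw [← RingHom.mem_ker, PadicInt.ker_toZMod]
  exact PadicInt.mem_nonunits.mpr hza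

/-- If a product of powers of `p`-adic units is a square and the Legendre symbols of the units are
`(-1) ^ e i`, then the weighted sum of the exponents is even. -/
lemma even_of_sq_eq_prod_zpow (hp : p ≠ 2) {ι : Type*} [Fintype ι] {c : ι → ℤ_[p]} {e : ι → ℕ}
    (hc : ∀ i, PadicInt.toZMod (c i) ^ ((p - 1) / 2) = (-1) ^ e i) {n : ι → ℤ} {s : ℚ_[p]}
    (hs : s ^ 2 = ∏ i, (c i : ℚ_[p]) ^ n i) : Even (∑ i, (e i : ℤ) * n i) := by
  have hpp := (Fact.out : p.Prime)
  have hp3 : 2 < p := lt_of_le_of_ne hpp.two_le hp.symm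
  have hhalf : 2 * ((p - 1) / 2) = p - 1 := by
    have := hpp.odd_of_ne_two hp
    obtain ⟨k, hk⟩ := this
    omega
  have hcu : ∀ i, ‖c i‖ = 1 := fun i ↦ by
    apply norm_eq_one_of_toZMod_ne_zero
    intro h
    have := hc i
    rw [h, zero_pow (by omega)] at this
    exact pow_ne_zero _ (neg_ne_zero.mpr one_ne_zero) this.symm
  have hsn : ‖s‖ = 1 := by
    have := congrArg norm hs
    rw [norm_pow, norm_prod] at this
    simp only [norm_zpow, ← PadicInt.norm_def, hcu, one_zpow, Finset.prod_const_one] at this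
    exact (pow_eq_one_iff_of_nonneg (norm_nonneg _) two_ne_zero).mp this
  let v : ℤ_[p]ˣ := PadicInt.mkUnits hsn
  let u : ι → ℤ_[p]ˣ := fun i ↦ PadicInt.mkUnits (u := (c i : ℚ_[p])) (hcu i)
  have hu : ∀ i, (u i : ℤ_[p]) = c i := fun i ↦ rfl
  have huv : v ^ 2 = ∏ i, u i ^ n i := by
    let j : ℤ_[p]ˣ →* ℚ_[p]ˣ := Units.map (algebraMap ℤ_[p] ℚ_[p]).toMonoidHom
    have hj : Function.Injective j :=
      Units.map_injective (f := (algebraMap ℤ_[p] ℚ_[p]).toMonoidHom)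
        (FaithfulSMul.algebraMap_injective ℤ_[p] ℚ_[p])
    apply hj
    rw [map_pow, map_prod]
    simp only [map_zpow]
    apply Units.ext
    rw [Units.val_pow_eq_pow_val, Units.coe_prod]
    simp only [Units.val_zpow_eq_zpow_val]
    exact hs
  -- Reduce modulo `p` and raise to the power `(p - 1) / 2`: the square becomes `1` by Fermat, the
  -- product becomes a power of `-1`.
  have key := congrArg (fun w ↦ Units.map (PadicInt.toZMod (p := p)).toMonoidHom w ^ ((p - 1) / 2))
    huv
  simp only [map_pow, map_prod, map_zpow] at key
  have hfin : ∀ i, Units.map (PadicInt.toZMod (p := p)).toMonoidHom (u i) ^ ((p - 1) / 2) =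
      (-1) ^ e i := fun i ↦ by
    apply Units.ext
    rw [Units.val_pow_eq_pow_val, Units.val_pow_eq_pow_val]
    exact hc i
  rw [← pow_mul, hhalf, ZMod.units_pow_card_sub_one_eq_one, ← Finset.prod_pow] at key
  have h3 : ∀ i, (Units.map (PadicInt.toZMod (p := p)).toMonoidHom (u i) ^ n i) ^ ((p - 1) / 2) =
      (-1) ^ ((e i : ℤ) * n i) := fun i ↦ by
    rw [← zpow_natCast, ← zpow_mul, mul_comm, zpow_mul, zpow_natCast, hfin, ← zpow_natCast,
      ← zpow_mul]
  simp only [h3] at key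
  have hsum : ∀ t : Finset ι, ∏ i ∈ t, (-1 : (ZMod p)ˣ) ^ ((e i : ℤ) * n i) =
      (-1) ^ (∑ i ∈ t, (e i : ℤ) * n i) := fun t ↦ by
    classical
    induction t using Finset.induction_on with
    | empty => simp
    | insert i t hi ih => rw [Finset.prod_insert hi, Finset.sum_insert hi, ih, zpow_add]
  rw [hsum] at key
  by_contra hodd
  rw [Int.not_even_iff_odd] at hodd
  rw [hodd.neg_one_zpow] at key
  have h4 : (1 : ZMod p) = -1 := by simpa using congrArg Units.val key
  have : Fact (2 < p) := ⟨hp3⟩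
  exact ZMod.neg_one_ne_one h4.symm

/-- An element of `K` with a `p`-adic embedding that sends `t` to an integer congruent to `20`. -/
def HasPadicEmbedding {K : Type*} [Field K] (t : K) (p : ℕ) [Fact p.Prime] : Prop :=
  ∃ (φ : K →+* ℚ_[p]) (τ : ℤ_[p]), φ t = τ ∧ PadicInt.toZMod τ = 20

lemma hasPadicEmbedding_rat (p : ℕ) [Fact p.Prime] : HasPadicEmbedding (20 : ℚ) p :=
  ⟨algebraMap ℚ ℚ_[p], 20, map_ofNat (algebraMap ℚ ℚ_[p]) 20, map_ofNat _ _⟩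

/-- Transcendental numbers are dense in `ℚ_p`. -/
lemma exists_transcendental_near (x : ℚ_[p]) {ε : ℝ} (hε : 0 < ε) :
    ∃ τ : ℚ_[p], Transcendental ℚ τ ∧ ‖τ - x‖ < ε := by
  have hd : Dense {τ : ℚ_[p] | IsAlgebraic ℚ τ}ᶜ :=
    (Algebraic.countable ℚ ℚ_[p]).dense_compl ℚ_[p]
  obtain ⟨τ, hτ, hd⟩ := Metric.dense_iff.mp hd x ε hε
  exact ⟨τ, hd, by simpa [dist_eq_norm] using hτ⟩

/-- Evaluation at a transcendental `τ` is injective on `ℚ[X]`, so it extends to the fraction field;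
choosing `‖τ - 20‖ < 1` gives `τ ≡ 20` modulo `p`. -/
lemma hasPadicEmbedding_ratFunc (p : ℕ) [Fact p.Prime] :
    HasPadicEmbedding (RatFunc.X : RatFunc ℚ) p := by
  obtain ⟨τ, hτ, hn⟩ := exists_transcendental_near (20 : ℚ_[p]) one_pos
  have hτ1 : ‖τ‖ ≤ 1 := by
    have h20 : ‖(20 : ℚ_[p])‖ ≤ 1 := by
      exact_mod_cast Padic.norm_int_le_one (p := p) 20
    calc ‖τ‖ = ‖τ - 20 + 20‖ := by rw [sub_add_cancel]
      _ ≤ max ‖τ - 20‖ ‖(20 : ℚ_[p])‖ := Padic.nonarchimedean _ _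
      _ ≤ 1 := max_le hn.le h20
  have hinj : Function.Injective (aeval τ : ℚ[X] →ₐ[ℚ] ℚ_[p]).toRingHom :=
    transcendental_iff_injective.mp hτ
  let τ' : ℤ_[p] := ⟨τ, hτ1⟩
  refine ⟨IsFractionRing.lift (A := ℚ[X]) (K := RatFunc ℚ) hinj, τ', ?_, ?_⟩
  · rw [← RatFunc.algebraMap_X, IsFractionRing.lift_algebraMap]
    exact aeval_X τ
  · have h20 : PadicInt.toZMod (20 : ℤ_[p]) = 20 := map_ofNat _ _
    rw [← sub_eq_zero, ← h20, ← map_sub, ← RingHom.mem_ker, PadicInt.ker_toZMod]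
    exact PadicInt.mem_nonunits.mpr hn

end Padic

/-! ### Independence for parameters close to `20`. -/

section Specialization

open WeierstrassCurve.Affine

variable {K : Type*} [Field K] [CharZero K] {t : K}

instance fact_prime_seventeen : Fact (Nat.Prime 17) := ⟨by norm_num⟩

/-- The `2`-division polynomial has no root modulo `17`, so there is no `2`-torsion. -/
lemma twoDivision_ne_zero (ht : HasPadicEmbedding t 17) (x : K) :
    4 * x ^ 3 + invB₂ t * x ^ 2 + 2 * invB₄ t * x + invB₆ t ≠ 0 := by
  intro h
  obtain ⟨φ, τ, hφ, hτ⟩ := ht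
  have h1 := congrArg φ h
  simp only [map_add, map_mul, map_pow, map_ofNat, map_invB₂, map_invB₄, map_invB₆, map_zero,
    hφ] at h1
  have hcoe : ((τ : ℤ_[17]) : ℚ_[17]) = algebraMap ℤ_[17] ℚ_[17] τ := rfl
  rw [hcoe, ← map_invB₂, ← map_invB₄, ← map_invB₆] at h1
  -- The root need not be integral, but `4x` satisfies the monic equation obtained on multiplying by
  -- `16`, so it can be reduced modulo `17`.
  have hint : IsIntegral ℤ_[17] (4 * φ x) := by
    refine ⟨X ^ 3 + (C (invB₂ τ) * X ^ 2 + C (8 * invB₄ τ) * X + C (16 * invB₆ τ)), ?_, ?_⟩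
    · apply monic_X_pow_add
      compute_degree!
    · simp only [eval₂_add, eval₂_mul, eval₂_C, eval₂_X_pow, eval₂_X, eval₂_ofNat, map_mul, map_ofNat]
      linear_combination 16 * h1
  obtain ⟨η, hη⟩ := IsIntegrallyClosed.isIntegral_iff.mp hint
  have h2 : η ^ 3 + invB₂ τ * η ^ 2 + 8 * invB₄ τ * η + 16 * invB₆ τ = 0 := by
    apply FaithfulSMul.algebraMap_injective ℤ_[17] ℚ_[17]
    simp only [map_add, map_mul, map_pow, map_ofNat, map_zero, hη]
    linear_combination 16 * h1
  have h3 := congrArg (PadicInt.toZMod (p := 17)) h2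
  simp only [map_add, map_mul, map_pow, map_ofNat, map_invB₂, map_invB₄, map_invB₆, map_zero,
    hτ] at h3
  revert h3
  generalize PadicInt.toZMod η = z
  revert z
  decide +kernel

/-- The integral expression for `4Δ` is nonzero modulo `17` at `t = 20`. -/
lemma isElliptic_cubic (ht : HasPadicEmbedding t 17) :
    (cubic t).IsElliptic := by
  refine ⟨isUnit_iff_ne_zero.mpr fun h ↦ ?_⟩
  obtain ⟨φ, τ, hφ, hτ⟩ := ht
  have h1 := congrArg φ (four_mul_cubic_Δ t)
  rw [h, mul_zero, map_zero] at h1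
  simp only [map_add, map_sub, map_neg, map_mul, map_pow, map_ofNat, map_invB₂, map_invB₄,
    map_invB₆, hφ] at h1
  have h2 : (0 : ℤ_[17]) = -invB₂ τ ^ 2 * (invB₂ τ * invB₆ τ - invB₄ τ ^ 2) - 32 * invB₄ τ ^ 3 -
      108 * invB₆ τ ^ 2 + 36 * invB₂ τ * invB₄ τ * invB₆ τ := by
    apply FaithfulSMul.algebraMap_injective ℤ_[17] ℚ_[17]
    simp only [map_add, map_sub, map_neg, map_mul, map_pow, map_ofNat, map_invB₂, map_invB₄,
      map_invB₆, map_zero]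
    exact h1
  have h3 := congrArg (PadicInt.toZMod (p := 17)) h2
  simp only [map_add, map_sub, map_neg, map_mul, map_pow, map_ofNat, map_invB₂, map_invB₄,
    map_invB₆, map_zero, hτ] at h3
  revert h3
  decide +kernel

/-- Completing the square. The left side vanishes exactly at `2`-torsion, and it is the denominator
in the duplication formula. -/
lemma psi_sq {x y : K} (h : (cubic t).toAffine.Equation x y) :
    (2 * y + (cubic t).a₁ * x + (cubic t).a₃) ^ 2 =
      4 * x ^ 3 + invB₂ t * x ^ 2 + 2 * invB₄ t * x + invB₆ t := by
  rw [equation_iff] at h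
  rw [← cubic_b₂, ← cubic_b₄, ← cubic_b₆, WeierstrassCurve.b₂, WeierstrassCurve.b₄,
    WeierstrassCurve.b₆]
  linear_combination 4 * h

lemma eq_zero_of_two_nsmul [DecidableEq K] (ht : HasPadicEmbedding t 17)
    (P : (cubic t).toAffine.Point) (hP : 2 • P = 0) : P = 0 := by
  rcases P with _ | ⟨x, y, h⟩
  · rfl
  exfalso
  rw [two_nsmul, add_eq_zero_iff_eq_neg, Point.neg_some, Point.some.injEq] at hP
  have hy := hP.2
  rw [negY] at hy
  apply twoDivision_ne_zero ht x
  rw [← psi_sq h.1]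
  have : 2 * y + (cubic t).a₁ * x + (cubic t).a₃ = 0 := by linear_combination hy
  rw [this]; ring

/-- A relation among the seven points gives a parity condition on its coefficients at every prime
with a simple root `θ₀` of the `2`-division polynomial modulo `p`. -/
lemma even_of_relation [DecidableEq K] (h17 : HasPadicEmbedding t 17)
    {p : ℕ} [Fact p.Prime] (hp : p ≠ 2) (ht : HasPadicEmbedding t p) (θ₀ : ZMod p) (e : Fin 7 → ℕ)
    (h0 : 4 * θ₀ ^ 3 + invB₂ 20 * θ₀ ^ 2 + 2 * invB₄ 20 * θ₀ + invB₆ 20 = 0)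
    (h1 : 12 * θ₀ ^ 2 + 2 * invB₂ 20 * θ₀ + 2 * invB₄ 20 ≠ 0)
    (he : ∀ i, (scaledX 20 i - 36 * θ₀) ^ ((p - 1) / 2) = (-1) ^ e i)
    {P : Fin 7 → (cubic t).toAffine.Point} (hP : ∀ i, ∃ h, P i = .some (pointX t i) (pointY t i) h)
    {n : Fin 7 → ℤ} (hn : ∑ i, n i • P i = 0) : Even (∑ i, (e i : ℤ) * n i) := by
  obtain ⟨φ, τ, hφ, hτ⟩ := ht
  obtain ⟨θ, hθ, hθ₀⟩ := exists_root_lift (invB₂ τ) (invB₄ τ) (invB₆ τ) θ₀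
    (by simpa only [map_invB₂, map_invB₄, map_invB₆, hτ] using h0)
    (by simpa only [map_invB₂, map_invB₄, map_invB₆, hτ] using h1)
  have hcoe : φ t = algebraMap ℤ_[p] ℚ_[p] τ := hφ
  have hroot : IsTwoTorsionX (cubic t) φ (algebraMap ℤ_[p] ℚ_[p] θ) := by
    rw [IsTwoTorsionX, cubic_b₂, cubic_b₄, cubic_b₆, map_invB₂, map_invB₄, map_invB₆, hcoe,
      ← map_invB₂, ← map_invB₄, ← map_invB₆]
    simpa only [map_add, map_mul, map_pow, map_ofNat, map_zero] using
      congrArg (algebraMap ℤ_[p] ℚ_[p]) hθ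
  have hne : ∀ x y, (cubic t).toAffine.Equation x y → φ x - algebraMap ℤ_[p] ℚ_[p] θ ≠ 0 := by
    intro x y _ hx
    apply twoDivision_ne_zero h17 x
    apply φ.injective
    rw [IsTwoTorsionX, cubic_b₂, cubic_b₄, cubic_b₆, ← sub_eq_zero.mp hx] at hroot
    simpa only [map_add, map_mul, map_pow, map_ofNat, map_zero] using hroot
  obtain ⟨s, hs⟩ := exists_sq_eq_prod_zpow two_ne_zero hroot hne hP hn
  -- The factor `36` clears the denominators `4` and `9` of the coordinates and, being a square,
  -- does not change the class.
  have hc : ∀ i, ((scaledX τ i - 36 * θ : ℤ_[p]) : ℚ_[p]) =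
      6 ^ 2 * (φ (pointX t i) - algebraMap ℤ_[p] ℚ_[p] θ) := fun i ↦ by
    have h36 : φ (scaledX t i) = 36 * φ (pointX t i) := by
      rw [scaledX_eq, map_mul, map_ofNat]
    rw [map_scaledX, hcoe, ← map_scaledX] at h36
    change algebraMap ℤ_[p] ℚ_[p] (scaledX τ i - 36 * θ) = _
    rw [map_sub, map_mul, map_ofNat, h36]
    ring
  refine even_of_sq_eq_prod_zpow hp (c := fun i ↦ scaledX τ i - 36 * θ) (e := e) (n := n)
    (s := (∏ i, 6 ^ n i) * s) (fun i ↦ ?_) ?_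
  · rw [map_sub, map_mul, map_ofNat, map_scaledX, hτ, hθ₀, he]
  · simp only [hc, mul_zpow, Finset.prod_mul_distrib, mul_pow, hs, ← Finset.prod_pow]
    congr 1
    refine Finset.prod_congr rfl fun i _ ↦ ?_
    rw [← zpow_natCast, ← zpow_natCast, ← zpow_mul, ← zpow_mul, mul_comm]

end Specialization

section Specialization

variable {K : Type*} [Field K] [CharZero K] {t : K}

instance fact_prime_nineteen : Fact (Nat.Prime 19) := ⟨by norm_num⟩

instance fact_prime_twentythree : Fact (Nat.Prime 23) := ⟨by norm_num⟩

instance fact_prime_fortyone : Fact (Nat.Prime 41) := ⟨by norm_num⟩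

instance fact_prime_fortythree : Fact (Nat.Prime 43) := ⟨by norm_num⟩

instance fact_prime_fortyseven : Fact (Nat.Prime 47) := ⟨by norm_num⟩

instance fact_prime_fiftynine : Fact (Nat.Prime 59) := ⟨by norm_num⟩

/-- The seven transformed points are independent over `ℤ` whenever `t` is close to `20` in
suitable `p`-adic embeddings. -/
theorem linearIndependent_points [DecidableEq K]
    (ht : ∀ (p : ℕ) [Fact p.Prime], HasPadicEmbedding t p)
    {P : Fin 7 → (cubic t).toAffine.Point}
    (hP : ∀ i, ∃ h, P i = .some (pointX t i) (pointY t i) h) : LinearIndependent ℤ P := by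
  have h17 := ht 17
  refine linearIndependent_of_even (eq_zero_of_two_nsmul h17) fun n hn ↦ ?_
  have h0 := even_of_relation h17 (p := 19) (by norm_num) (ht 19) 2 ![1, 1, 1, 0, 1, 1, 0]
    (by decide +kernel) (by decide +kernel) (by decide +kernel) hP hn
  have h1 := even_of_relation h17 (p := 19) (by norm_num) (ht 19) 3 ![1, 1, 0, 0, 1, 0, 0]
    (by decide +kernel) (by decide +kernel) (by decide +kernel) hP hn
  have h2 := even_of_relation h17 (p := 23) (by norm_num) (ht 23) 9 ![1, 0, 1, 0, 0, 1, 1]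
    (by decide +kernel) (by decide +kernel) (by decide +kernel) hP hn
  have h3 := even_of_relation h17 (p := 41) (by norm_num) (ht 41) 22 ![1, 0, 1, 0, 0, 1, 0]
    (by decide +kernel) (by decide +kernel) (by decide +kernel) hP hn
  have h4 := even_of_relation h17 (p := 43) (by norm_num) (ht 43) 36 ![0, 0, 1, 0, 1, 0, 1]
    (by decide +kernel) (by decide +kernel) (by decide +kernel) hP hn
  have h5 := even_of_relation h17 (p := 47) (by norm_num) (ht 47) 0 ![0, 0, 0, 0, 1, 0, 1]
    (by decide +kernel) (by decide +kernel) (by decide +kernel) hP hn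
  have h6 := even_of_relation h17 (p := 59) (by norm_num) (ht 59) 42 ![1, 0, 0, 1, 1, 0, 1]
    (by decide +kernel) (by decide +kernel) (by decide +kernel) hP hn
  simp only [Fin.sum_univ_seven, Matrix.cons_val, Int.even_iff] at h0 h1 h2 h3 h4 h5 h6
  push_cast at h0 h1 h2 h3 h4 h5 h6
  intro i
  rw [Int.even_iff]
  -- The primes and roots are chosen so that the seven exponent vectors are linearly independent
  -- over `𝔽₂`.
  have key : n 0 % 2 = 0 ∧ n 1 % 2 = 0 ∧ n 2 % 2 = 0 ∧ n 3 % 2 = 0 ∧ n 4 % 2 = 0 ∧ n 5 % 2 = 0 ∧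
      n 6 % 2 = 0 := by omega
  obtain ⟨g0, g1, g2, g3, g4, g5, g6⟩ := key
  fin_cases i
  exacts [g0, g1, g2, g3, g4, g5, g6]

end Specialization

/-! ### Tate's limit argument. -/

section TateLimit

/-- Tate's telescoping argument: if `u (n + 1) = 4 u n + O(1)`, then `u n / 4 ^ n` converges, with
an explicit error bound. -/
lemma exists_tendsto_div_four_pow {u : ℕ → ℝ} {B : ℝ} (h : ∀ n, |u (n + 1) - 4 * u n| ≤ B) :
    ∃ L, Tendsto (fun n ↦ u n / 4 ^ n) atTop (𝓝 L) ∧ ∀ n, |u n / 4 ^ n - L| ≤ B / (3 * 4 ^ n) := by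
  have hd : ∀ n, dist (u n / 4 ^ n) (u (n + 1) / 4 ^ (n + 1)) ≤ B / 4 * (1 / 4) ^ n := fun n ↦ by
    rw [dist_comm, Real.dist_eq]
    have : u (n + 1) / 4 ^ (n + 1) - u n / 4 ^ n = (u (n + 1) - 4 * u n) / 4 ^ (n + 1) := by
      field_simp
      ring
    rw [this, abs_div, abs_of_pos (by positivity : (0 : ℝ) < 4 ^ (n + 1)), one_div, inv_pow,
      div_mul_eq_mul_div, ← div_eq_mul_inv, div_div, ← pow_succ]
    gcongr
    exact h n
  obtain ⟨L, hL⟩ := cauchySeq_tendsto_of_complete (cauchySeq_of_le_geometric _ _ (by norm_num) hd)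
  refine ⟨L, hL, fun n ↦ ?_⟩
  have := dist_le_of_le_geometric_of_tendsto _ _ (by norm_num) hd hL n
  rw [Real.dist_eq] at this
  refine this.trans_eq ?_
  rw [one_div, inv_pow]
  field_simp
  norm_num

end TateLimit

/-! ### Duplication in the coordinate `ξ` and its cancellation. -/

section Duplication

open WeierstrassCurve.Affine

/-- The duplication formula on a Weierstrass curve. -/
lemma addX_slope_self {K : Type*} [Field K] [DecidableEq K] (W : WeierstrassCurve K) {x y : K}
    (h : W.toAffine.Equation x y) (hy : y ≠ W.toAffine.negY x y) :
    W.toAffine.addX x x (W.toAffine.slope x x y y) * (2 * y + W.a₁ * x + W.a₃) ^ 2 =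
      x ^ 4 - W.b₄ * x ^ 2 - 2 * W.b₆ * x - W.b₈ := by
  have hψ : 2 * y + W.a₁ * x + W.a₃ ≠ 0 := fun h0 ↦ hy (by rw [negY]; linear_combination h0)
  have hℓ : W.toAffine.slope x x y y * (2 * y + W.a₁ * x + W.a₃) =
      3 * x ^ 2 + 2 * W.a₂ * x + W.a₄ - W.a₁ * y := by
    rw [slope_of_Y_ne rfl hy, negY, show y - (-y - W.toAffine.a₁ * x - W.toAffine.a₃) =
      2 * y + W.a₁ * x + W.a₃ by ring, div_mul_cancel₀ _ hψ]
  rw [equation_iff] at h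
  rw [addX, WeierstrassCurve.b₄, WeierstrassCurve.b₆, WeierstrassCurve.b₈]
  linear_combination (W.toAffine.slope x x y y * (2 * y + W.a₁ * x + W.a₃) +
    (3 * x ^ 2 + 2 * W.a₂ * x + W.a₄ - W.a₁ * y) + W.a₁ * (2 * y + W.a₁ * x + W.a₃)) * hℓ -
    (8 * x + W.a₁ ^ 2 + 4 * W.a₂) * h

/-- Numerator of the duplication formula in the coordinate `ξ = (x - 8834705000) / 40000` on the
curve at `T = 20`. -/
def dupNum (a b : ℤ) : ℤ :=
  a * a * (a * a) + 401696906866 * (a * a * (b * b)) - 201224706562690104 * (a * b * (b * b)) +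
    40340000634074688140437 * (b * b * (b * b))

/-- Denominator of the duplication formula in the coordinate `ξ`. -/
def dupDen (a b : ℤ) : ℤ :=
  4 * (a * a * (a * b)) + 4 * (a * a * (b * b)) - 803393813732 * (a * b * (b * b)) +
    100612353281345052 * (b * b * (b * b))

/-- A quarter of the discriminant of the model of the curve in the coordinate `ξ`. -/
def quarterDisc : ℤ := 61306379384463756907514566416000000

/-- Together with `bezout_right`, this makes the coprimality of the two duplication forms effective:
it bounds their common divisors at coprime arguments, and bounds their maximum from below. -/
lemma bezout_left (a b : ℤ) :
    (61306379384463756907514566416000000 * a ^ 3 + 4058726721596585408010319634480161698676 * a ^ 2 * b - 8345464066312021092870429631411308000595181016 * a * b ^ 2 + 917827315510004494681063109317903399377958493718564 * b ^ 3) * dupNum a b + (-1014681680399146352002579908620040424669 * a ^ 3 - 4070278711213464369093626329853845232874780077 * a ^ 2 * b + 2243245053211230045764041119154144113960102494534405 * a * b ^ 2 - 367998096477379935393074313993375560843510154996148127259 * b ^ 3) * dupDen a b = quarterDisc * a ^ 7 := by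
  simp only [dupNum, dupDen, quarterDisc]; ring

lemma bezout_right (a b : ℤ) :
    (-12 * a ^ 2 * b - 8 * a * b ^ 2 + 3213575254932 * b ^ 3) * dupNum a b + (3 * a ^ 3 - 1 * a ^ 2 * b + 1004242267165 * a * b ^ 2 - 679133786345985967 * b ^ 3) * dupDen a b = quarterDisc * b ^ 7 := by
  simp only [dupNum, dupDen, quarterDisc]; ring

/-- The Bezout identities make the gcd divide `quarterDisc * a ^ 7` and `quarterDisc * b ^ 7`, where
`a ^ 7` and `b ^ 7` are coprime. -/
lemma gcd_dup_dvd {a b : ℤ} (h : IsCoprime a b) :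
    (Int.gcd (dupNum a b) (dupDen a b) : ℤ) ∣ quarterDisc := by
  have h7 : IsCoprime (a ^ 7) (b ^ 7) := h.pow
  obtain ⟨u, v, huv⟩ := h7
  have h1 : (Int.gcd (dupNum a b) (dupDen a b) : ℤ) ∣ quarterDisc * a ^ 7 := by
    rw [← bezout_left]
    exact dvd_add ((Int.gcd_dvd_left ..).mul_left _) ((Int.gcd_dvd_right ..).mul_left _)
  have h2 : (Int.gcd (dupNum a b) (dupDen a b) : ℤ) ∣ quarterDisc * b ^ 7 := by
    rw [← bezout_right]
    exact dvd_add ((Int.gcd_dvd_left ..).mul_left _) ((Int.gcd_dvd_right ..).mul_left _)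
  have : quarterDisc = u * (quarterDisc * a ^ 7) + v * (quarterDisc * b ^ 7) := by
    linear_combination (-quarterDisc) * huv
  rw [this]
  exact dvd_add (h1.mul_left _) (h2.mul_left _)

lemma gcd_dup_pos {a b : ℤ} (h : IsCoprime a b) : 0 < Int.gcd (dupNum a b) (dupDen a b) :=
  Nat.pos_of_ne_zero fun h0 ↦ by
    have := gcd_dup_dvd h
    rw [h0, Nat.cast_zero, zero_dvd_iff] at this
    exact absurd this (by decide)

lemma cubic_twenty : cubic (20 : ℚ) =
    { a₁ := -11486800
      a₂ := -33013147635000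
      a₃ := 15163200000000
      a₄ := -113872078125000000
      a₆ := 3759275726644878984375000000000 } := by
  rw [cubic_eq]; norm_num

/-- The point `Q` has coordinate `ξ = a / b` in lowest terms. -/
def Represents (Q : (cubic (20 : ℚ)).toAffine.Point) (a b : ℤ) : Prop :=
  IsCoprime a b ∧ ((b = 0 ∧ Q = 0) ∨
    (b ≠ 0 ∧ ∃ y h, Q = .some (40000 * ((a : ℚ) / b) + 8834705000) y h))

lemma represents_some {x y : ℚ} (h : (cubic (20 : ℚ)).toAffine.Nonsingular x y) :
    Represents (.some x y h) ((x - 8834705000) / 40000).num ((x - 8834705000) / 40000).den := by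
  refine ⟨Rat.isCoprime_num_den _, .inr ⟨by simp, y, ?_⟩⟩
  have hx : x = 40000 * ((((x - 8834705000) / 40000).num : ℚ) /
      ((((x - 8834705000) / 40000).den : ℤ) : ℚ)) + 8834705000 := by
    rw [Int.cast_natCast, Rat.num_div_den]; ring
  have key : ∀ x', x = x' → ∃ h' : (cubic (20 : ℚ)).toAffine.Nonsingular x' y,
      WeierstrassCurve.Affine.Point.some x y h = .some x' y h' := by
    rintro _ rfl
    exact ⟨h, rfl⟩
  exact key _ hx

lemma exists_represents (Q : (cubic (20 : ℚ)).toAffine.Point) : ∃ a b, Represents Q a b := by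
  rcases Q with _ | ⟨x, y, h⟩
  · exact ⟨1, 0, isCoprime_one_left, .inl ⟨rfl, rfl⟩⟩
  · exact ⟨_, _, represents_some h⟩

/-- The homogeneous duplication formula needs no exceptions: `dupDen a b` vanishes when `b = 0` and
when the point is `2`-torsion, the cases in which the double is at infinity. -/
lemma Represents.two_nsmul {Q : (cubic (20 : ℚ)).toAffine.Point} {a b : ℤ}
    (hQ : Represents Q a b) :
    Represents (2 • Q) (dupNum a b / (Int.gcd (dupNum a b) (dupDen a b) : ℤ))
      (dupDen a b / (Int.gcd (dupNum a b) (dupDen a b) : ℤ)) := by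
  obtain ⟨hab, hQ⟩ := hQ
  have hg := gcd_dup_pos hab
  have hg0 : ((Int.gcd (dupNum a b) (dupDen a b) : ℤ)) ≠ 0 := by exact_mod_cast hg.ne'
  refine ⟨Int.isCoprime_iff_gcd_eq_one.mpr (Int.gcd_ediv_gcd_ediv_gcd hg), ?_⟩
  rcases hQ with ⟨rfl, rfl⟩ | ⟨hb, y, h, rfl⟩
  · left
    simp [dupDen]
  · rw [_root_.two_nsmul]
    set x : ℚ := 40000 * ((a : ℚ) / b) + 8834705000 with hx
    have hbq : (b : ℚ) ≠ 0 := by exact_mod_cast hb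
    have hψ : (2 * y + (cubic (20 : ℚ)).a₁ * x + (cubic (20 : ℚ)).a₃) ^ 2 * (b : ℚ) ^ 4 =
        40000 ^ 3 * dupDen a b := by
      have h1 := psi_sq h.1
      rw [h1, hx]
      simp only [invB₂, invB₄, invB₆, dupDen]
      push_cast
      field_simp
      ring
    by_cases hy : y = (cubic (20 : ℚ)).toAffine.negY x y
    · left
      refine ⟨?_, Point.add_self_of_Y_eq hy⟩
      rw [WeierstrassCurve.Affine.negY] at hy
      have h0 : 2 * y + (cubic (20 : ℚ)).a₁ * x + (cubic (20 : ℚ)).a₃ = 0 := by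
        linear_combination hy
      rw [h0] at hψ
      have : dupDen a b = 0 := by
        have h2 : (40000 ^ 3 * dupDen a b : ℚ) = 0 := by rw [← hψ]; ring
        have h3 := (mul_eq_zero.mp h2).resolve_left (by norm_num)
        exact_mod_cast h3
      rw [this, Int.zero_ediv]
    · right
      have h0 : 2 * y + (cubic (20 : ℚ)).a₁ * x + (cubic (20 : ℚ)).a₃ ≠ 0 := fun h0 ↦
        hy (by rw [WeierstrassCurve.Affine.negY]; linear_combination h0)
      have hden : (dupDen a b : ℚ) ≠ 0 := fun h1 ↦ by
        rw [h1, mul_zero] at hψ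
        exact mul_ne_zero (pow_ne_zero 2 h0) (pow_ne_zero 4 hbq) hψ
      have hdenz : dupDen a b ≠ 0 := by exact_mod_cast hden
      refine ⟨?_, ?_⟩
      · intro h1
        exact hdenz (by
          rw [← Int.mul_ediv_cancel' (Int.gcd_dvd_right (dupNum a b) (dupDen a b)), h1, mul_zero])
      · have hquot : (((dupNum a b / (Int.gcd (dupNum a b) (dupDen a b) : ℤ) : ℤ) : ℚ) /
            ((dupDen a b / (Int.gcd (dupNum a b) (dupDen a b) : ℤ) : ℤ) : ℚ)) =
            (dupNum a b : ℚ) / dupDen a b := by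
          rw [Int.cast_div (Int.gcd_dvd_left ..) (by exact_mod_cast hg0),
            Int.cast_div (Int.gcd_dvd_right ..) (by exact_mod_cast hg0),
            div_div_div_cancel_right₀ (by exact_mod_cast hg0)]
        have hX : (cubic (20 : ℚ)).toAffine.addX x x ((cubic (20 : ℚ)).toAffine.slope x x y y) =
            40000 * ((dupNum a b : ℚ) / dupDen a b) + 8834705000 := by
          have h1 := addX_slope_self _ h.1 hy
          -- The affine change `x = 40000ξ + 8834705000` acts on the numerator of `x(2P)`; division
          -- by `hψ` undoes it on the quotient.
          have h2 : (x ^ 4 - (cubic (20 : ℚ)).b₄ * x ^ 2 - 2 * (cubic (20 : ℚ)).b₆ * x -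
              (cubic (20 : ℚ)).b₈) * (b : ℚ) ^ 4 =
              40000 ^ 4 * dupNum a b + 8834705000 * (40000 ^ 3 * dupDen a b) := by
            rw [hx, cubic_b₄, cubic_b₆, WeierstrassCurve.b₈, cubic_twenty]
            simp only [invB₄, invB₆, dupNum, dupDen]
            push_cast
            field_simp
            ring
          rw [← h1, mul_assoc, hψ] at h2
          field_simp
          linear_combination h2 / 40000 ^ 3
        rw [Point.add_of_Y_ne hy, hquot]
        have key : ∀ x₁ y₁ (h₁ : (cubic (20 : ℚ)).toAffine.Nonsingular x₁ y₁) x', x₁ = x' →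
            ∃ y' h', WeierstrassCurve.Affine.Point.some x₁ y₁ h₁ = .some x' y' h' := by
          rintro x₁ y₁ h₁ _ rfl
          exact ⟨y₁, h₁, rfl⟩
        exact key _ _ _ _ hX

end Duplication

/-! ### Height change under doubling, and existence of the canonical height. -/

section HeightBound

/-- The height of the coordinate `ξ = (x - 8834705000) / 40000`. -/
noncomputable def modelHeight : (cubic (20 : ℚ)).toAffine.Point → ℝ
  | .zero => 0
  | .some x _ _ => Height.logHeight₁ ((x - 8834705000) / 40000)

lemma Represents.modelHeight_eq {Q : (cubic (20 : ℚ)).toAffine.Point} {a b : ℤ}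
    (hQ : Represents Q a b) : modelHeight Q = Real.log (max |a| |b| : ℤ) := by
  obtain ⟨hab, ⟨rfl, rfl⟩ | ⟨hb, y, h, rfl⟩⟩ := hQ
  · have ha : |a| = 1 := Int.isUnit_iff_abs_eq.mp (isCoprime_zero_right.mp hab)
    rw [ha]
    simp only [abs_zero, zero_le_one, sup_of_le_left, Int.cast_one, Real.log_one]
    rfl
  · have hξ : (40000 * ((a : ℚ) / b) + 8834705000 - 8834705000) / 40000 = (a : ℚ) / b := by ring
    have hgcd : (Finset.univ : Finset (Fin 2)).gcd ![a, b] = 1 := by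
      simpa [Finset.univ_fin2, Finset.gcd_insert, ← Int.coe_gcd, ← Int.abs_eq_normalize, Int.gcd,
        Int.natAbs_abs] using
        Int.isCoprime_iff_gcd_eq_one.mp hab
    have hmax : (⨆ i : Fin 2, |![a, b] i|) = max |a| |b| := by
      refine le_antisymm (ciSup_le fun i ↦ ?_) (max_le ?_ ?_)
      · fin_cases i <;> simp
      · exact Finite.le_ciSup_of_le 0 (by simp)
      · exact Finite.le_ciSup_of_le 1 (by simp)
    have := Rat.logHeight_eq_max_abs_of_gcd_eq_one hgcd
    rw [hmax] at this
    rw [modelHeight, hξ, Height.logHeight₁_div_eq_logHeight, ← this]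
    congr 1
    ext i
    fin_cases i <;> rfl

lemma max_abs_pos {a b : ℤ} (h : IsCoprime a b) : 0 < max |a| |b| := by
  rw [lt_max_iff, abs_pos, abs_pos]
  by_contra! h0
  rw [h0.1, h0.2] at h
  exact not_isCoprime_zero_zero h

/-- A quartic form is bounded by the sum of the absolute values of its coefficients. -/
lemma abs_form_le {m a b : ℤ} (ha : |a| ≤ m) (hb : |b| ≤ m) :
    |dupNum a b| ≤ 2 ^ 76 * m ^ 4 ∧ |dupDen a b| ≤ 2 ^ 76 * m ^ 4 := by
  have hm : 0 ≤ m := (abs_nonneg a).trans ha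
  have key : ∀ x y z w : ℤ, |x| ≤ m → |y| ≤ m → |z| ≤ m → |w| ≤ m → |x * y * (z * w)| ≤ m ^ 4 := by
    intro x y z w hx hy hz hw
    rw [abs_mul, abs_mul, abs_mul]
    calc |x| * |y| * (|z| * |w|) ≤ m * m * (m * m) := by gcongr
      _ = m ^ 4 := by ring
  have h1 := abs_le.mp (key a a a a ha ha ha ha)
  have h2 := abs_le.mp (key a a a b ha ha ha hb)
  have h3 := abs_le.mp (key a a b b ha ha hb hb)
  have h4 := abs_le.mp (key a b b b ha hb hb hb)
  have h5 := abs_le.mp (key b b b b hb hb hb hb)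
  have hm4 : 0 ≤ m ^ 4 := by positivity
  constructor <;> rw [abs_le] <;> simp only [dupNum, dupDen] <;> constructor <;> linarith

/-- A cubic form is bounded by the sum of the absolute values of its coefficients. -/
lemma abs_cubic_form_le {m a b : ℤ} (ha : |a| ≤ m) (hb : |b| ≤ m) (c₀ c₁ c₂ c₃ : ℤ) :
    |c₀ * a ^ 3 + c₁ * (a ^ 2 * b) + c₂ * (a * b ^ 2) + c₃ * b ^ 3| ≤
      (|c₀| + |c₁| + |c₂| + |c₃|) * m ^ 3 := by
  have hm : 0 ≤ m := (abs_nonneg a).trans ha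
  have h0 : |a ^ 3| ≤ m ^ 3 := by rw [abs_pow]; gcongr
  have h1 : |a ^ 2 * b| ≤ m ^ 3 := by
    rw [abs_mul, abs_pow, pow_succ m]; gcongr
  have h2 : |a * b ^ 2| ≤ m ^ 3 := by
    rw [abs_mul, abs_pow, pow_succ' m]; gcongr
  have h3 : |b ^ 3| ≤ m ^ 3 := by rw [abs_pow]; gcongr
  calc _ ≤ |c₀ * a ^ 3| + |c₁ * (a ^ 2 * b)| + |c₂ * (a * b ^ 2)| + |c₃ * b ^ 3| :=
        (abs_add_le _ _).trans (by gcongr; exact (abs_add_le _ _).trans (by gcongr; exact abs_add_le _ _))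
    _ ≤ |c₀| * m ^ 3 + |c₁| * m ^ 3 + |c₂| * m ^ 3 + |c₃| * m ^ 3 := by
        simp only [abs_mul c₀, abs_mul c₁, abs_mul c₂, abs_mul c₃]; gcongr
    _ = _ := by ring

/-- The lower bound for the duplication forms obtained from the Bezout identities. -/
lemma quarterDisc_mul_pow_le {m a b : ℤ} (hm : max |a| |b| = m) (hm0 : 0 < m) :
    quarterDisc * m ^ 4 ≤ 2 ^ 188 * max |dupNum a b| |dupDen a b| := by
  have ha : |a| ≤ m := hm ▸ le_max_left _ _
  have hb : |b| ≤ m := hm ▸ le_max_right _ _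
  set M := max |dupNum a b| |dupDen a b|
  have hM0 : 0 ≤ M := (abs_nonneg _).trans (le_max_left _ _)
  have bound : ∀ (c₀ c₁ c₂ c₃ d₀ d₁ d₂ d₃ x : ℤ), |x| = m →
      (c₀ * a ^ 3 + c₁ * (a ^ 2 * b) + c₂ * (a * b ^ 2) + c₃ * b ^ 3) * dupNum a b +
      (d₀ * a ^ 3 + d₁ * (a ^ 2 * b) + d₂ * (a * b ^ 2) + d₃ * b ^ 3) * dupDen a b =
        quarterDisc * x ^ 7 →
      |c₀| + |c₁| + |c₂| + |c₃| + (|d₀| + |d₁| + |d₂| + |d₃|) ≤ 2 ^ 188 →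
      quarterDisc * m ^ 4 ≤ 2 ^ 188 * M := by
    intro c₀ c₁ c₂ c₃ d₀ d₁ d₂ d₃ x hx hbez hsum
    have h1 : quarterDisc * m ^ 7 ≤ (2 ^ 188 * M) * m ^ 3 := by
      calc quarterDisc * m ^ 7 = |quarterDisc * x ^ 7| := by
            rw [abs_mul, abs_pow, hx]; rfl
        _ ≤ (|c₀| + |c₁| + |c₂| + |c₃|) * m ^ 3 * M + (|d₀| + |d₁| + |d₂| + |d₃|) * m ^ 3 * M := by
            rw [← hbez]
            refine (abs_add_le _ _).trans ?_
            rw [abs_mul, abs_mul]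
            gcongr
            · exact abs_cubic_form_le ha hb ..
            · exact le_max_left _ _
            · exact abs_cubic_form_le ha hb ..
            · exact le_max_right _ _
        _ = (|c₀| + |c₁| + |c₂| + |c₃| + (|d₀| + |d₁| + |d₂| + |d₃|)) * (M * m ^ 3) := by ring
        _ ≤ 2 ^ 188 * (M * m ^ 3) := by gcongr
        _ = _ := by ring
    have h2 : quarterDisc * m ^ 7 = quarterDisc * m ^ 4 * m ^ 3 := by ring
    rw [h2] at h1
    exact le_of_mul_le_mul_right h1 (by positivity)
  -- Use the Bezout identity for whichever of `a`, `b` attains the maximum; `2 ^ 188` bounds the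
  -- sums of the coefficients of the cofactors.
  rcases max_choice |a| |b| with h | h
  · refine bound 61306379384463756907514566416000000 4058726721596585408010319634480161698676 (-8345464066312021092870429631411308000595181016) 917827315510004494681063109317903399377958493718564 (-1014681680399146352002579908620040424669) (-4070278711213464369093626329853845232874780077) 2243245053211230045764041119154144113960102494534405 (-367998096477379935393074313993375560843510154996148127259) a (h ▸ hm) ?_ (by norm_num)
    rw [← bezout_left a b]; ring
  · refine bound 0 (-12) (-8) 3213575254932 3 (-1) 1004242267165 (-679133786345985967) b (h ▸ hm) ?_ (by norm_num)
    rw [← bezout_right a b]; ring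

/-- Doubling multiplies the height by `4`, up to a bounded error. -/
lemma abs_modelHeight_two_nsmul_sub_le (Q : (cubic (20 : ℚ)).toAffine.Point) :
    |modelHeight (2 • Q) - 4 * modelHeight Q| ≤ 188 * Real.log 2 := by
  obtain ⟨a, b, hQ⟩ := exists_represents Q
  rw [hQ.modelHeight_eq, hQ.two_nsmul.modelHeight_eq]
  have hg := gcd_dup_pos hQ.1
  have hgd := gcd_dup_dvd hQ.1
  set g : ℤ := (Int.gcd (dupNum a b) (dupDen a b) : ℤ) with hgdef
  have hg0 : 0 < g := Int.natCast_pos.mpr hg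
  set m := max |a| |b| with hm
  have hm0 : 0 < m := max_abs_pos hQ.1
  have hm0' : 0 < max |dupNum a b / g| |dupDen a b / g| := max_abs_pos hQ.two_nsmul.1
  set m' := max |dupNum a b / g| |dupDen a b / g| with hm'
  have hmm : g * m' = max |dupNum a b| |dupDen a b| := by
    rw [hm', mul_max_of_nonneg _ _ hg0.le]
    congr 1
    · nth_rw 1 [← abs_of_pos hg0]
      rw [← abs_mul, Int.mul_ediv_cancel' (Int.gcd_dvd_left ..)]
    · nth_rw 1 [← abs_of_pos hg0]
      rw [← abs_mul, Int.mul_ediv_cancel' (Int.gcd_dvd_right ..)]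
  have hup : m' ≤ 2 ^ 188 * m ^ 4 := by
    have h1 := abs_form_le (le_max_left |a| |b|) (le_max_right |a| |b|)
    calc m' ≤ g * m' := le_mul_of_one_le_left hm0'.le hg0
      _ ≤ 2 ^ 76 * m ^ 4 := hmm ▸ max_le h1.1 h1.2
      _ ≤ 2 ^ 188 * m ^ 4 := by gcongr <;> norm_num
  have hlow : m ^ 4 ≤ 2 ^ 188 * m' := by
    have h1 := quarterDisc_mul_pow_le hm.symm hm0
    have hD : 0 < quarterDisc := by decide
    have h2 : g ≤ quarterDisc := Int.le_of_dvd hD hgd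
    -- Cancellation loses at most the factor `quarterDisc`, exactly what the Bezout identity gains.
    have h3 : quarterDisc * m ^ 4 ≤ quarterDisc * (2 ^ 188 * m') := by
      calc quarterDisc * m ^ 4 ≤ 2 ^ 188 * (g * m') := hmm ▸ h1
        _ ≤ 2 ^ 188 * (quarterDisc * m') := by gcongr
        _ = _ := by ring
    exact le_of_mul_le_mul_left h3 hD
  have hmR : (0 : ℝ) < m := by exact_mod_cast hm0
  have hmR' : (0 : ℝ) < m' := by exact_mod_cast hm0'
  have hupR : (m' : ℝ) ≤ 2 ^ 188 * (m : ℝ) ^ 4 := by exact_mod_cast hup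
  have hlowR : (m : ℝ) ^ 4 ≤ 2 ^ 188 * (m' : ℝ) := by exact_mod_cast hlow
  have h1 := Real.log_le_log hmR' hupR
  have h2 := Real.log_le_log (by positivity) hlowR
  rw [Real.log_mul (by positivity) (by positivity), Real.log_pow, Real.log_pow] at h1 h2
  push_cast at h1 h2
  rw [abs_le]
  constructor <;> linarith

/-- The naive height differs from the height of `ξ` by a bounded amount. -/
lemma exists_abs_naiveHeight_sub_le :
    ∃ B, ∀ Q : (cubic (20 : ℚ)).toAffine.Point, |naiveHeight Q - modelHeight Q| ≤ B := by
  set w := Height.totalWeight ℚ * Real.log 2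
  have hw : 0 ≤ w := by positivity
  have e0 := Height.zero_le_logHeight₁ (K := ℚ) 40000
  have e1 := Height.zero_le_logHeight₁ (K := ℚ) 8834705000
  refine ⟨w + Height.logHeight₁ (40000 : ℚ) + Height.logHeight₁ (8834705000 : ℚ), fun Q ↦ ?_⟩
  rcases Q with _ | ⟨x, y, h⟩
  · simp only [naiveHeight, modelHeight, sub_self, abs_zero]
    positivity
  · simp only [naiveHeight, modelHeight]
    set ξ := (x - 8834705000) / 40000 with hξ
    have hx : x = 40000 * ξ + 8834705000 := by rw [hξ]; ring
    have h1 := Height.logHeight₁_add_le (40000 * ξ) 8834705000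
    have h2 := Height.logHeight₁_mul_le 40000 ξ
    have h3 := Height.logHeight₁_sub_le x 8834705000
    have h4 := Height.logHeight₁_mul_le (x - 8834705000) (40000)⁻¹
    rw [Height.logHeight₁_inv, ← div_eq_mul_inv, ← hξ] at h4
    rw [← hx] at h1
    rw [abs_le]
    constructor <;> linarith

lemma tendsto_naiveHeight_sub (Q : (cubic (20 : ℚ)).toAffine.Point) :
    Tendsto (fun n : ℕ ↦ naiveHeight ((2 ^ n : ℕ) • Q) / 4 ^ n -
      modelHeight ((2 ^ n : ℕ) • Q) / 4 ^ n) atTop (𝓝 0) := by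
  obtain ⟨B, hB⟩ := exists_abs_naiveHeight_sub_le
  have hlim : Tendsto (fun n : ℕ ↦ B * (1 / 4 : ℝ) ^ n) atTop (𝓝 0) := by
    simpa using (tendsto_pow_atTop_nhds_zero_of_lt_one (by norm_num : (0 : ℝ) ≤ 1 / 4)
      (by norm_num)).const_mul B
  refine squeeze_zero_norm (fun n ↦ ?_) hlim
  rw [← sub_div, Real.norm_eq_abs, abs_div, abs_of_pos (by positivity : (0 : ℝ) < 4 ^ n), one_div,
    inv_pow, ← div_eq_mul_inv]
  gcongr
  exact hB _

/-- The canonical height exists, and it is approximated by the heights of `2 ^ n • Q`. -/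
theorem exists_isCanonicalHeight :
    ∃ ĥ : (cubic (20 : ℚ)).toAffine.Point → ℝ, IsCanonicalHeight ĥ ∧ ∀ Q (n : ℕ),
      |modelHeight ((2 ^ n : ℕ) • Q) / 4 ^ n - ĥ Q| ≤ 188 * Real.log 2 / (3 * 4 ^ n) := by
  have h : ∀ Q : (cubic (20 : ℚ)).toAffine.Point, ∀ n : ℕ,
      |modelHeight ((2 ^ (n + 1) : ℕ) • Q) - 4 * modelHeight ((2 ^ n : ℕ) • Q)| ≤
        188 * Real.log 2 := fun Q n ↦ by
    rw [pow_succ', mul_nsmul']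
    exact abs_modelHeight_two_nsmul_sub_le _
  choose ĥ hlim hbound using fun Q ↦
    exists_tendsto_div_four_pow (u := fun n ↦ modelHeight ((2 ^ n : ℕ) • Q)) (h Q)
  refine ⟨ĥ, fun Q ↦ ?_, hbound⟩
  simpa using (tendsto_naiveHeight_sub Q).add (hlim Q)

lemma IsCanonicalHeight.two_nsmul {W : WeierstrassCurve ℚ} {ĥ : W.toAffine.Point → ℝ}
    (h : IsCanonicalHeight ĥ) (Q : W.toAffine.Point) : ĥ (2 • Q) = 4 * ĥ Q := by
  refine tendsto_nhds_unique (h (2 • Q)) ?_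
  have h1 := ((tendsto_add_atTop_iff_nat 1).mpr (h Q)).const_mul 4
  refine h1.congr fun n ↦ ?_
  rw [pow_succ, mul_nsmul', pow_succ]
  field_simp

end HeightBound

/-! ### Evaluation order and logarithms for kernel computation. -/

section Strict

/-- `f n`, arranged so that the kernel evaluates `n` before it is substituted. -/
def strictNat {α : Type*} (n : ℕ) (f : ℕ → α) : α :=
  match n with
  | 0 => f 0
  | m + 1 => f (m + 1)

/-- `f z`, arranged so that the kernel evaluates `z` before it is substituted. -/
def strictInt {α : Type*} (z : ℤ) (f : ℤ → α) : α :=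
  match z with
  | .ofNat n => strictNat n fun m ↦ f (.ofNat m)
  | .negSucc n => strictNat n fun m ↦ f (.negSucc m)

lemma strictNat_eq {α : Type*} (n : ℕ) (f : ℕ → α) : strictNat n f = f n := by
  cases n <;> rfl

lemma strictInt_eq {α : Type*} (z : ℤ) (f : ℤ → α) : strictInt z f = f z := by
  cases z <;> simp only [strictInt, strictNat_eq]

/-- `acc + log₂ n`, for `n < 2 ^ 2 ^ k`, by bisection. -/
def log2Bisect : ℕ → ℕ → ℕ → ℕ
  | 0, _, acc => acc
  | k + 1, n, acc =>
    strictNat (n / 2 ^ 2 ^ k) fun q ↦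
    match q with
    | 0 => log2Bisect k n acc
    | q' + 1 => strictNat (acc + 2 ^ k) fun acc' ↦ log2Bisect k (q' + 1) acc'

end Strict

/-! ### Approximate size of `2 ^ k • Q` without its exact coordinates. -/

section Algorithm

/-- The number of bits of `max (|A|, |B|)`, up to a bounded error, where `A / B` is the coordinate
`ξ` of `2 ^ k • Q` in lowest terms. The coordinates of the current point are known modulo
`quarterDisc ^ k` as `(a, b)`, and approximately as `(x, y) * 2 ^ e` with an error of at most
`ρ * 2 ^ e`. -/
def heightBits : ℕ → ℤ → ℤ → ℤ → ℤ → ℤ → ℤ → Option ℤ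
  | 0, _, _, x, y, ρ, e =>
    strictNat (max x.natAbs y.natAbs) fun m ↦
    strictNat (log2Bisect 16 m 0) fun l ↦
    -- This test certifies both the accumulated error and the value of `log2Bisect`, about which
    -- nothing is proved.
    if 2 * ρ ≤ (2 ^ l : ℕ) ∧ 2 ^ l ≤ m ∧ m ≤ 2 ^ (l + 1) then some (e + l) else none
  | k + 1, a, b, x, y, ρ, e =>
    strictInt (dupNum a b % ((quarterDisc.toNat ^ (k + 1) : ℕ) : ℤ)) fun a' ↦
    strictInt (dupDen a b % ((quarterDisc.toNat ^ (k + 1) : ℕ) : ℤ)) fun b' ↦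
    strictInt (Int.gcd (Int.gcd a' b') quarterDisc) fun g ↦
    strictInt (dupNum x y) fun x' ↦
    strictInt (dupDen x y) fun y' ↦
    strictInt ((x.natAbs + y.natAbs : ℕ) + ρ) fun M ↦
    strictInt ((2 ^ 78 : ℕ) * (M * M * M) * ρ) fun err ↦
    strictNat (log2Bisect 16 (x'.natAbs + y'.natAbs) 0 - 4000) fun s ↦
    strictInt (g * (2 ^ s : ℕ)) fun d ↦
    strictInt (a' / g) fun a'' ↦
    strictInt (b' / g) fun b'' ↦
    strictInt (x' / d) fun x'' ↦
    strictInt (y' / d) fun y'' ↦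
    -- One unit for rounding down `err / d` and one for rounding down the coordinate.
    strictInt (err / d + 2) fun ρ'' ↦
    strictInt (4 * e + s) fun e'' ↦
    heightBits k a'' b'' x'' y'' ρ'' e''

/-- `heightBits` started at the point with coordinate `ξ`. -/
def heightBitsOf (k : ℕ) (ξ : ℚ) : Option ℤ :=
  heightBits k ξ.num ξ.den (ξ.num * (2 ^ 4000 : ℕ)) (ξ.den * (2 ^ 4000 : ℕ)) 0 (-4000)

end Algorithm

/-! ### Correctness of the algorithm. -/

section Correctness

/-- The numerator of the duplication formula over `ℝ`. -/
noncomputable def dupNumReal (a b : ℝ) : ℝ :=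
  a * a * (a * a) + 401696906866 * (a * a * (b * b)) - 201224706562690104 * (a * b * (b * b)) +
    40340000634074688140437 * (b * b * (b * b))

/-- The denominator of the duplication formula over `ℝ`. -/
noncomputable def dupDenReal (a b : ℝ) : ℝ :=
  4 * (a * a * (a * b)) + 4 * (a * a * (b * b)) - 803393813732 * (a * b * (b * b)) +
    100612353281345052 * (b * b * (b * b))

lemma cast_dupNum (a b : ℤ) : (dupNum a b : ℝ) = dupNumReal a b := by
  simp only [dupNum, dupNumReal]; push_cast; ring

lemma cast_dupDen (a b : ℤ) : (dupDen a b : ℝ) = dupDenReal a b := by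
  simp only [dupDen, dupDenReal]; push_cast; ring

lemma dupNumReal_smul (c a b : ℝ) : dupNumReal (a * c) (b * c) = dupNumReal a b * c ^ 4 := by
  simp only [dupNumReal]; ring

lemma dupDenReal_smul (c a b : ℝ) : dupDenReal (a * c) (b * c) = dupDenReal a b * c ^ 4 := by
  simp only [dupDenReal]; ring

/-- Perturbation of a product of four factors. -/
lemma abs_prod_four_sub_le {M ρ : ℝ} {p q r s p' q' r' s' : ℝ}
    (hp : |p| ≤ M) (hq : |q| ≤ M) (hr : |r| ≤ M)
    (hq' : |q'| ≤ M) (hr' : |r'| ≤ M) (hs' : |s'| ≤ M)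
    (ep : |p - p'| ≤ ρ) (eq : |q - q'| ≤ ρ) (er : |r - r'| ≤ ρ) (es : |s - s'| ≤ ρ) :
    |p * q * (r * s) - p' * q' * (r' * s')| ≤ 4 * (M * M * M * ρ) := by
  have hM : 0 ≤ M := (abs_nonneg _).trans hp
  have hρ : 0 ≤ ρ := (abs_nonneg _).trans ep
  have h : p * q * (r * s) - p' * q' * (r' * s') = (p - p') * q' * r' * s' +
      p * (q - q') * r' * s' + p * q * (r - r') * s' + p * q * r * (s - s') := by ring
  rw [h]
  have h1 : |(p - p') * q' * r' * s'| ≤ ρ * M * M * M := by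
    simp only [abs_mul]; gcongr
  have h2 : |p * (q - q') * r' * s'| ≤ M * ρ * M * M := by
    simp only [abs_mul]; gcongr
  have h3 : |p * q * (r - r') * s'| ≤ M * M * ρ * M := by
    simp only [abs_mul]; gcongr
  have h4 : |p * q * r * (s - s')| ≤ M * M * M * ρ := by
    simp only [abs_mul]; gcongr
  rw [abs_le] at *
  constructor <;> linarith

lemma abs_dupReal_sub_le {M ρ a b x y : ℝ} (ha : |a| ≤ M) (hb : |b| ≤ M) (hx : |x| ≤ M)
    (hy : |y| ≤ M) (ea : |a - x| ≤ ρ) (eb : |b - y| ≤ ρ) :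
    |dupNumReal a b - dupNumReal x y| ≤ 2 ^ 78 * (M * M * M) * ρ ∧
      |dupDenReal a b - dupDenReal x y| ≤ 2 ^ 78 * (M * M * M) * ρ := by
  have hM : 0 ≤ M := (abs_nonneg _).trans ha
  have hρ : 0 ≤ ρ := (abs_nonneg _).trans ea
  have h1 := abs_le.mp (abs_prod_four_sub_le ha ha ha hx hx hx ea ea ea ea)
  have h2 := abs_le.mp (abs_prod_four_sub_le ha ha ha hx hx hy ea ea ea eb)
  have h3 := abs_le.mp (abs_prod_four_sub_le ha ha hb hx hy hy ea ea eb eb)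
  have h4 := abs_le.mp (abs_prod_four_sub_le ha hb hb hy hy hy ea eb eb eb)
  have h5 := abs_le.mp (abs_prod_four_sub_le hb hb hb hy hy hy eb eb eb eb)
  -- The constant `2 ^ 78` is `4`, from the perturbation of a product, times the bound `2 ^ 76` for
  -- the coefficient sums.
  have hpos : 0 ≤ M * M * M * ρ := by positivity
  constructor <;> rw [abs_le] <;> simp only [dupNumReal, dupDenReal] <;> constructor <;> linarith

/-- Rounding step for the floating point approximation. -/
lemma abs_div_sub_floor_le {z : ℝ} {x err d : ℤ} (hd : 0 < d) (h : |z - x| ≤ err) :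
    |z / d - (x / d : ℤ)| ≤ ((err / d + 2 : ℤ) : ℝ) := by
  have hdR : (0 : ℝ) < d := by exact_mod_cast hd
  have h1 : ∀ w : ℤ, ((w / d : ℤ) : ℝ) * d ≤ w ∧ (w : ℝ) < ((w / d : ℤ) : ℝ) * d + d := fun w ↦ by
    constructor
    · exact_mod_cast Int.ediv_mul_le w hd.ne'
    · have := Int.lt_ediv_add_one_mul_self w hd
      have h2 : (w : ℝ) < ((w / d : ℤ) + 1 : ℝ) * d := by exact_mod_cast this
      linarith
  have hx := h1 x
  have he := h1 err
  rw [abs_le] at h ⊢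
  push_cast
  constructor
  · rw [le_sub_iff_add_le, le_div_iff₀ hdR]
    nlinarith
  · rw [sub_le_iff_le_add, div_le_iff₀ hdR]
    nlinarith

/-- A gcd known to divide `D` can be read off from residues modulo any multiple of `D`. -/
lemma gcd_gcd_eq {F G a b D m : ℤ} (hD : (Int.gcd F G : ℤ) ∣ D) (hm : D ∣ m)
    (ha : m ∣ F - a) (hb : m ∣ G - b) : Int.gcd (Int.gcd a b) D = Int.gcd F G := by
  apply Nat.dvd_antisymm
  · have hgD : ((Int.gcd (Int.gcd a b) D : ℕ) : ℤ) ∣ D := Int.gcd_dvd_right ..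
    have hgab : ((Int.gcd (Int.gcd a b) D : ℕ) : ℤ) ∣ (Int.gcd a b : ℤ) := Int.gcd_dvd_left ..
    apply Int.natCast_dvd_natCast.mp
    apply Int.dvd_coe_gcd
    · have := dvd_add (((hgD.trans hm).trans ha)) (hgab.trans (Int.gcd_dvd_left ..))
      rwa [sub_add_cancel] at this
    · have := dvd_add (((hgD.trans hm).trans hb)) (hgab.trans (Int.gcd_dvd_right ..))
      rwa [sub_add_cancel] at this
  · apply Int.natCast_dvd_natCast.mp
    refine Int.dvd_coe_gcd (Int.dvd_coe_gcd ?_ ?_) hD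
    · have := dvd_sub (Int.gcd_dvd_left F G) ((hD.trans hm).trans ha)
      rwa [sub_sub_cancel] at this
    · have := dvd_sub (Int.gcd_dvd_right F G) ((hD.trans hm).trans hb)
      rwa [sub_sub_cancel] at this

/-- Dividing by a divisor of `D` costs at most one factor `D` of the modulus, so `k` doublings need
residues modulo `D ^ k`. -/
lemma dvd_ediv_sub_ediv {F a g D : ℤ} {k : ℕ} (hg : g ≠ 0) (hgD : g ∣ D) (hgF : g ∣ F)
    (ha : D ^ (k + 1) ∣ F - a) : D ^ k ∣ F / g - a / g := by
  have hga : g ∣ a := by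
    have := dvd_sub hgF ((hgD.trans (dvd_pow_self D k.succ_ne_zero)).trans ha)
    rwa [sub_sub_cancel] at this
  obtain ⟨F', rfl⟩ := hgF
  obtain ⟨a', rfl⟩ := hga
  rw [Int.mul_ediv_cancel_left _ hg, Int.mul_ediv_cancel_left _ hg]
  rw [← mul_sub] at ha
  have : g * D ^ k ∣ g * (F' - a') := (mul_dvd_mul_right hgD _).trans (by rwa [pow_succ'] at ha)
  exact Int.dvd_of_mul_dvd_mul_left hg this

lemma dvd_dup_sub {m A B a b : ℤ} (ha : m ∣ A - a) (hb : m ∣ B - b) :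
    m ∣ dupNum A B - dupNum a b ∧ m ∣ dupDen A B - dupDen a b := by
  have ha' : A ≡ a [ZMOD m] := (Int.modEq_iff_dvd.mpr ha).symm
  have hb' : B ≡ b [ZMOD m] := (Int.modEq_iff_dvd.mpr hb).symm
  constructor
  · apply Int.modEq_iff_dvd.mp
    unfold dupNum
    gcongr
  · apply Int.modEq_iff_dvd.mp
    unfold dupDen
    gcongr

/-- The congruences and the error bounds are the invariants of the recursion; `A` and `B` are the
true coordinates, which are never computed. -/
theorem heightBits_spec (k : ℕ) : ∀ (a b x y ρ e h A B : ℤ) (Q : (cubic (20 : ℚ)).toAffine.Point),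
    Represents Q A B → quarterDisc ^ k ∣ A - a → quarterDisc ^ k ∣ B - b →
    |(A : ℝ) - x * 2 ^ e| ≤ ρ * 2 ^ e → |(B : ℝ) - y * 2 ^ e| ≤ ρ * 2 ^ e →
    heightBits k a b x y ρ e = some h →
    |modelHeight ((2 ^ k : ℕ) • Q) - h * Real.log 2| ≤ 2 * Real.log 2 := by
  induction k with
  | zero =>
    intro a b x y ρ e h A B Q hQ _ _ hA hB hh
    simp only [heightBits, strictNat_eq] at hh
    set m : ℕ := max x.natAbs y.natAbs with hm
    set l : ℕ := log2Bisect 16 m 0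
    split_ifs at hh with hc
    obtain ⟨hρ, hl, hu⟩ := hc
    rw [Option.some_inj] at hh
    rw [pow_zero, one_nsmul, hQ.modelHeight_eq, ← hh]
    have hE : (0 : ℝ) < 2 ^ e := by positivity
    have hρR : 2 * (ρ : ℝ) ≤ 2 ^ l := by exact_mod_cast hρ
    have hlR : (2 : ℝ) ^ l ≤ m := by exact_mod_cast hl
    have huR : (m : ℝ) ≤ 2 ^ l * 2 := by
      rw [← pow_succ]; exact_mod_cast hu
    have hmR : (m : ℝ) = max |(x : ℝ)| |(y : ℝ)| := by
      rw [hm, Nat.cast_max, Nat.cast_natAbs, Nat.cast_natAbs, Int.cast_abs, Int.cast_abs]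
    have habs : ∀ z w : ℝ, |z - w * 2 ^ e| ≤ ρ * 2 ^ e →
        |z| ≤ (|w| + ρ) * 2 ^ e ∧ (|w| - ρ) * 2 ^ e ≤ |z| := fun z w hz ↦ by
      have hw : |w * 2 ^ e| = |w| * 2 ^ e := by rw [abs_mul, abs_of_pos hE]
      have h1 := abs_sub_abs_le_abs_sub z (w * 2 ^ e)
      have h2 := abs_sub_abs_le_abs_sub (w * 2 ^ e) z
      rw [abs_sub_comm] at h2
      rw [hw] at h1 h2
      constructor <;> linarith
    have hA' := habs _ _ hA
    have hB' := habs _ _ hB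
    have hmaxR : ((max |A| |B| : ℤ) : ℝ) = max |(A : ℝ)| |(B : ℝ)| := by push_cast; rfl
    have hpos : (0 : ℝ) < ((max |A| |B| : ℤ) : ℝ) := by exact_mod_cast max_abs_pos hQ.1
    -- The error is at most `2 ^ (l - 1)` units and `2 ^ l ≤ m ≤ 2 ^ (l + 1)`, so the maximum lies
    -- between `2 ^ (e + l - 1)` and `2 ^ (e + l + 2)`.
    have hupper : ((max |A| |B| : ℤ) : ℝ) ≤ 2 ^ (e + l) * 2 ^ (2 : ℕ) := by
      rw [hmaxR, zpow_add₀ two_ne_zero, zpow_natCast]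
      have hx : |(x : ℝ)| ≤ m := hmR ▸ le_max_left _ _
      have hy : |(y : ℝ)| ≤ m := hmR ▸ le_max_right _ _
      refine max_le (hA'.1.trans ?_) (hB'.1.trans ?_)
      · rw [mul_assoc, mul_comm]; gcongr; linarith
      · rw [mul_assoc, mul_comm]; gcongr; linarith
    have hlower : 2 ^ (e + l) / 2 ≤ ((max |A| |B| : ℤ) : ℝ) := by
      rw [hmaxR, zpow_add₀ two_ne_zero, zpow_natCast]
      have hmm : (2 : ℝ) ^ e * 2 ^ l / 2 ≤ (m - ρ) * 2 ^ e := by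
        rw [mul_div_assoc, mul_comm]; gcongr; linarith
      refine hmm.trans ?_
      rcases max_choice |(x : ℝ)| |(y : ℝ)| with h' | h'
      · rw [hmR, h']; exact hA'.2.trans (le_max_left _ _)
      · rw [hmR, h']; exact hB'.2.trans (le_max_right _ _)
    have h1 := Real.log_le_log hpos hupper
    have h2 := Real.log_le_log (by positivity) hlower
    rw [Real.log_mul (by positivity) (by positivity), Real.log_zpow, Real.log_pow] at h1
    rw [Real.log_div (by positivity) (by positivity), Real.log_zpow] at h2
    have hlog := Real.log_pos (one_lt_two)
    push_cast at h1 h2 ⊢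
    rw [abs_le]
    constructor <;> linarith
  | succ k ih =>
    intro a b x y ρ e h A B Q hQ ha hb hA hB hh
    simp only [heightBits, strictNat_eq, strictInt_eq] at hh
    have hD : ((quarterDisc.toNat ^ (k + 1) : ℕ) : ℤ) = quarterDisc ^ (k + 1) := by
      push_cast; rfl
    rw [hD] at hh
    set F := dupNum A B with hF
    set G := dupDen A B with hG
    set a' := dupNum a b % quarterDisc ^ (k + 1) with ha'
    set b' := dupDen a b % quarterDisc ^ (k + 1) with hb'
    have hdvd := dvd_dup_sub ha hb
    have hFa : quarterDisc ^ (k + 1) ∣ F - a' := by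
      have := dvd_add hdvd.1 (Int.dvd_self_sub_emod (x := dupNum a b) (m := quarterDisc ^ (k + 1)))
      rwa [sub_add_sub_cancel] at this
    have hGb : quarterDisc ^ (k + 1) ∣ G - b' := by
      have := dvd_add hdvd.2 (Int.dvd_self_sub_emod (x := dupDen a b) (m := quarterDisc ^ (k + 1)))
      rwa [sub_add_sub_cancel] at this
    have hgD := gcd_dup_dvd hQ.1
    have hgcd : Int.gcd (Int.gcd a' b') quarterDisc = Int.gcd F G :=
      gcd_gcd_eq hgD (dvd_pow_self _ k.succ_ne_zero) hFa hGb
    rw [hgcd] at hh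
    have hg : 0 < Int.gcd F G := gcd_dup_pos hQ.1
    set g : ℤ := (Int.gcd F G : ℤ) with hgdef
    have hg0 : 0 < g := Int.natCast_pos.mpr hg
    -- The shift only keeps the numbers at about `4000` bits; the argument works for any `s`.
    set s : ℕ := log2Bisect 16 ((dupNum x y).natAbs + (dupDen x y).natAbs) 0 - 4000
    set d : ℤ := g * (2 ^ s : ℕ) with hd
    have hd0 : 0 < d := by positivity
    set M : ℤ := (x.natAbs + y.natAbs : ℕ) + ρ with hM
    set err : ℤ := (2 ^ 78 : ℕ) * (M * M * M) * ρ with herr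
    have hE : (0 : ℝ) < 2 ^ e := by positivity
    set α : ℝ := A / 2 ^ e with hα
    set β : ℝ := B / 2 ^ e with hβ
    have hAα : (A : ℝ) = α * 2 ^ e := by rw [hα]; field_simp
    have hBβ : (B : ℝ) = β * 2 ^ e := by rw [hβ]; field_simp
    have hscale : ∀ z w : ℝ, |z * 2 ^ e - w * 2 ^ e| ≤ ρ * 2 ^ e → |z - w| ≤ ρ := fun z w hz ↦ by
      rw [← sub_mul, abs_mul, abs_of_pos hE] at hz
      exact le_of_mul_le_mul_right hz hE
    rw [hAα] at hA
    rw [hBβ] at hB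
    have eα := hscale _ _ hA
    have eβ := hscale _ _ hB
    have hρ0 : (0 : ℝ) ≤ ρ := (abs_nonneg _).trans eα
    have hMR : (M : ℝ) = |(x : ℝ)| + |(y : ℝ)| + ρ := by
      rw [hM]; push_cast; rfl
    have hx0 := abs_nonneg (x : ℝ)
    have hy0 := abs_nonneg (y : ℝ)
    have hxM : |(x : ℝ)| ≤ M := by rw [hMR]; linarith
    have hyM : |(y : ℝ)| ≤ M := by rw [hMR]; linarith
    have hαM : |α| ≤ M := by
      have := abs_sub_abs_le_abs_sub α x
      rw [hMR]; linarith
    have hβM : |β| ≤ M := by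
      have := abs_sub_abs_le_abs_sub β y
      rw [hMR]; linarith
    have herrR : (err : ℝ) = 2 ^ 78 * (M * M * M) * ρ := by rw [herr]; push_cast; ring
    obtain ⟨hnum, hden⟩ := abs_dupReal_sub_le hαM hβM hxM hyM eα eβ
    rw [← herrR, ← cast_dupNum] at hnum
    rw [← herrR, ← cast_dupDen] at hden
    have hnum' := abs_div_sub_floor_le hd0 hnum
    have hden' := abs_div_sub_floor_le hd0 hden
    have hpow : (2 : ℝ) ^ (4 * e + s) = (2 ^ e) ^ 4 * 2 ^ s := by
      rw [zpow_add₀ two_ne_zero, zpow_natCast, mul_comm 4 e, zpow_mul]; rfl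
    have hstep : ∀ (z : ℝ) (w : ℤ) (N : ℤ), (N : ℝ) = z * (2 ^ e) ^ 4 → g ∣ N →
        |z / d - (w / d : ℤ)| ≤ ((err / d + 2 : ℤ) : ℝ) →
        |((N / g : ℤ) : ℝ) - (w / d : ℤ) * 2 ^ (4 * e + s)| ≤
          ((err / d + 2 : ℤ) : ℝ) * 2 ^ (4 * e + s) := by
      intro z w N hN hgN hz
      have hgR : (g : ℝ) ≠ 0 := by exact_mod_cast hg0.ne'
      have h1 : ((N / g : ℤ) : ℝ) = z / d * 2 ^ (4 * e + s) := by
        rw [Int.cast_div hgN hgR, hN, hpow, hd]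
        push_cast
        field_simp
      rw [h1, ← sub_mul, abs_mul, abs_of_pos (by positivity : (0 : ℝ) < 2 ^ (4 * e + s))]
      gcongr
    have h1 := hstep _ _ F (by rw [hF, cast_dupNum, hAα, hBβ, dupNumReal_smul])
      (Int.gcd_dvd_left ..) hnum'
    have h2 := hstep _ _ G (by rw [hG, cast_dupDen, hAα, hBβ, dupDenReal_smul])
      (Int.gcd_dvd_right ..) hden'
    have := ih _ _ _ _ _ _ _ _ _ _ hQ.two_nsmul
      (dvd_ediv_sub_ediv hg0.ne' hgD (Int.gcd_dvd_left ..) hFa)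
      (dvd_ediv_sub_ediv hg0.ne' hgD (Int.gcd_dvd_right ..) hGb) h1 h2 hh
    rwa [← mul_nsmul', ← pow_succ] at this

theorem heightBitsOf_spec {k : ℕ} {x y : ℚ} {h : (cubic (20 : ℚ)).toAffine.Nonsingular x y} {n : ℤ}
    (hn : heightBitsOf k ((x - 8834705000) / 40000) = some n) :
    |modelHeight ((2 ^ k : ℕ) • WeierstrassCurve.Affine.Point.some x y h) - n * Real.log 2| ≤
      2 * Real.log 2 := by
  have hz : ∀ z : ℤ, |(z : ℝ) - (z * (2 ^ 4000 : ℕ) : ℤ) * 2 ^ (-4000 : ℤ)| ≤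
      ((0 : ℤ) : ℝ) * 2 ^ (-4000 : ℤ) := fun z ↦ by
    have h4000 : (2 : ℝ) ^ (-4000 : ℤ) = ((2 : ℝ) ^ 4000)⁻¹ := by
      rw [zpow_neg]; rfl
    rw [h4000, Int.cast_mul, Int.cast_natCast, Nat.cast_pow, Nat.cast_ofNat,
      mul_inv_cancel_right₀ (by positivity)]
    simp
  exact heightBits_spec k _ _ _ _ _ _ _ _ _ _ (represents_some h) (by simp) (by simp)
    (hz _) (hz _) hn

end Correctness

/-! ### Numerical data at `T = 20`. -/

section Data

/-- The `X`-coordinates of the seven points for `t = 20`. -/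
def coordX : Fin 7 → ℚ :=
  ![-8853975000, 25675425000, 33013147635000, 14353625000, 122279625000, 4881465000,
    57943825000 / 9]

/-- The `Y`-coordinates of the seven points for `t = 20`. -/
def coordY : Fin 7 → ℚ :=
  ![-49533002415000000, 148443624945000000, 379215409090518000000, 82496985025000000,
    740044530225000000, 29707439553000000, 1039711347115000000 / 27]

/-- The `X`-coordinate of the sum of the `i`-th and the `j`-th point for `t = 20`. -/
def sumX (i j : Fin 7) : ℚ :=
  -- The chord formula `λ² + a₁λ - a₂ - xᵢ - xⱼ` with the coefficients at `t = 20`.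
  ((coordY i - coordY j) / (coordX i - coordX j)) ^ 2 -
    11486800 * ((coordY i - coordY j) / (coordX i - coordX j)) + 33013147635000 -
    coordX i - coordX j

/-- `pointBits i / 4 ^ 30` approximates `ĥ(Pᵢ) / log 2`, where `Pᵢ` is the `i`-th point for
`t = 20`. -/
def pointBits : Fin 7 → ℤ :=
  ![12452166527560392139, 12810423784842476938, 27968924955317133620, 13784100074042664610,
    10975729395380363858, 15116495389273691000, 21093266150812451816]

/-- `sumBits i j / 4 ^ 30` approximates `ĥ(Pᵢ + Pⱼ) / log 2`. -/
def sumBits : Matrix (Fin 7) (Fin 7) ℤ :=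
  !![49808666110241568556, 42724047091942855770, 68056394575493587624, 40182054627187563650,
      33849867306345190583, 41264285877707510486, 52835402337904440702;
    42724047091942855770, 51241695139369907752, 68150586610376994505, 41593548998783390974,
      34116471942508278103, 42535779386091969888, 54333196987955206152;
    68056394575493587624, 68150586610376994505, 111875699821268534480, 70706932857467999048,
      60062616655507559730, 71924511781539109521, 89198452676213766695;
    40182054627187563650, 41593548998783390974, 70706932857467999048, 55136400296170658440,
      35408801709425681632, 47053047143722872751, 54844588605624271980;
    33849867306345190583, 34116471942508278103, 60062616655507559730, 35408801709425681632,
      43902917581521455432, 35164817443822615466, 52432025850773982448;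
    41264285877707510486, 42535779386091969888, 71924511781539109521, 47053047143722872751,
      35164817443822615466, 60465981557094764000, 51722096548297177692;
    52835402337904440702, 54333196987955206152, 89198452676213766695, 54844588605624271980,
      52432025850773982448, 51722096548297177692, 84373064603249807264]

/-- `pairingBits i j / (2 * 4 ^ 30)` approximates `⟨Pᵢ, Pⱼ⟩ / log 2`. -/
def pairingBits : Matrix (Fin 7) (Fin 7) ℤ :=
  .of fun i j ↦ sumBits i j - pointBits i - pointBits j

lemma heightBitsOf_coordX :
    ∀ i, heightBitsOf 30 ((coordX i - 8834705000) / 40000) = some (pointBits i) := by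
  decide +kernel

lemma heightBitsOf_sumX :
    ∀ i j, i < j → heightBitsOf 30 ((sumX i j - 8834705000) / 40000) = some (sumBits i j) := by
  decide +kernel

lemma sumBits_comm (i j : Fin 7) : sumBits i j = sumBits j i := by
  rw [← sub_eq_zero]
  revert i j
  decide +kernel

/-- Diagonal entries need no separate run of the algorithm, because `ĥ(2P) = 4ĥ(P)`. -/
lemma sumBits_self : ∀ i : Fin 7, sumBits i i = 4 * pointBits i := by
  decide +kernel

lemma coordX_ne : ∀ i j, i < j → coordX i ≠ coordX j := by
  decide +kernel

lemma pointX_twenty (i : Fin 7) : pointX (20 : ℚ) i = coordX i := by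
  fin_cases i <;> simp [pointX, coordX] <;> norm_num

lemma pointY_twenty (i : Fin 7) : pointY (20 : ℚ) i = coordY i := by
  fin_cases i <;> simp [pointY, coordY] <;> norm_num

end Data

/-! ### Error bounds for the height pairings. -/

section Bounds

open WeierstrassCurve.Affine

variable {P : Fin 7 → (cubic (20 : ℚ)).toAffine.Point}

lemma exists_add_eq_some (hP : ∀ i, ∃ h, P i = .some (coordX i) (coordY i) h) {i j : Fin 7}
    (hij : i < j) : ∃ y h, P i + P j = .some (sumX i j) y h := by
  obtain ⟨hi, ei⟩ := hP i
  obtain ⟨hj, ej⟩ := hP j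
  have hx := coordX_ne i j hij
  rw [ei, ej, Point.add_of_X_ne hx]
  have : (cubic (20 : ℚ)).toAffine.addX (coordX i) (coordX j)
      ((cubic (20 : ℚ)).toAffine.slope (coordX i) (coordX j) (coordY i) (coordY j)) =
      sumX i j := by
    rw [slope_of_X_ne hx, addX, cubic_twenty, sumX]
    ring
  generalize_proofs h
  revert h
  rw [this]
  exact fun h ↦ ⟨_, h, rfl⟩

variable {ĥ : (cubic (20 : ℚ)).toAffine.Point → ℝ}

/-- In units of `log 2 / 4 ^ 30`, the algorithm contributes an error of `2` and the limit `188 / 3`,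
together less than `65`. -/
lemma abs_canonicalHeight_sub_le (hb : ∀ Q (n : ℕ),
      |modelHeight ((2 ^ n : ℕ) • Q) / 4 ^ n - ĥ Q| ≤ 188 * Real.log 2 / (3 * 4 ^ n))
    {x y : ℚ} {h : (cubic (20 : ℚ)).toAffine.Nonsingular x y} {n : ℤ}
    (hn : heightBitsOf 30 ((x - 8834705000) / 40000) = some n) :
    |ĥ (.some x y h) - n * (Real.log 2 / 4 ^ 30)| ≤ 65 * (Real.log 2 / 4 ^ 30) := by
  have h1 := heightBitsOf_spec (h := h) hn
  have h2 := hb (.some x y h) 30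
  have hl := Real.log_pos one_lt_two
  revert h1 h2
  generalize modelHeight _ = m
  intro h1 h2
  have hN : (0 : ℝ) < 4 ^ 30 := by positivity
  generalize (4 : ℝ) ^ 30 = N at *
  have h3 : |m / N - n * (Real.log 2 / N)| ≤ 2 * (Real.log 2 / N) := by
    rw [← mul_div_assoc, ← sub_div, abs_div, abs_of_pos hN, ← mul_div_assoc]
    gcongr
  have h4 : 188 * Real.log 2 / (3 * N) = 188 / 3 * (Real.log 2 / N) := by field_simp
  have h5 : 0 < Real.log 2 / N := by positivity
  rw [h4] at h2
  rw [abs_le] at *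
  constructor <;> linarith

/-- The bound `260 = 4 * 65` is dictated by the diagonal; off the diagonal `65` would do. -/
lemma abs_canonicalHeight_add_sub_le (hĥ : IsCanonicalHeight ĥ) (hb : ∀ Q (n : ℕ),
      |modelHeight ((2 ^ n : ℕ) • Q) / 4 ^ n - ĥ Q| ≤ 188 * Real.log 2 / (3 * 4 ^ n))
    (hP : ∀ i, ∃ h, P i = .some (coordX i) (coordY i) h) (i j : Fin 7) :
    |ĥ (P i + P j) - sumBits i j * (Real.log 2 / 4 ^ 30)| ≤ 260 * (Real.log 2 / 4 ^ 30) := by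
  have hc : 0 < Real.log 2 / 4 ^ 30 := div_pos (Real.log_pos one_lt_two) (by positivity)
  generalize hc' : Real.log 2 / 4 ^ 30 = c at *
  rcases lt_trichotomy i j with hij | rfl | hij
  · obtain ⟨y, h, e⟩ := exists_add_eq_some hP hij
    have := abs_canonicalHeight_sub_le hb (h := h) (heightBitsOf_sumX i j hij)
    rw [hc'] at this
    rw [e]
    linarith
  · obtain ⟨h, e⟩ := hP i
    have := abs_canonicalHeight_sub_le hb (h := h) (heightBitsOf_coordX i)
    rw [hc', ← e] at this
    rw [← two_nsmul, hĥ.two_nsmul, sumBits_self, abs_le]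
    rw [abs_le] at this
    push_cast
    constructor <;> linarith
  · obtain ⟨y, h, e⟩ := exists_add_eq_some hP hij
    have := abs_canonicalHeight_sub_le hb (h := h) (heightBitsOf_sumX j i hij)
    rw [hc'] at this
    rw [add_comm, sumBits_comm, e]
    linarith

/-- The pairings are known up to a relative error of about `10 ^ (-17)`. -/
theorem abs_heightMatrix_sub_le (hĥ : IsCanonicalHeight ĥ) (hb : ∀ Q (n : ℕ),
      |modelHeight ((2 ^ n : ℕ) • Q) / 4 ^ n - ĥ Q| ≤ 188 * Real.log 2 / (3 * 4 ^ n))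
    (hP : ∀ i, ∃ h, P i = .some (coordX i) (coordY i) h) (i j : Fin 7) :
    |heightMatrix ĥ P i j / (Real.log 2 / (2 * 4 ^ 30)) - pairingBits i j| ≤ 390 := by
  have hc : 0 < Real.log 2 / 4 ^ 30 := div_pos (Real.log_pos one_lt_two) (by positivity)
  have h1 := abs_canonicalHeight_add_sub_le hĥ hb hP i j
  have h2 : ∀ i, |ĥ (P i) - pointBits i * (Real.log 2 / 4 ^ 30)| ≤
      65 * (Real.log 2 / 4 ^ 30) := fun i ↦ by
    obtain ⟨h, e⟩ := hP i
    rw [e]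
    exact abs_canonicalHeight_sub_le hb (heightBitsOf_coordX i)
  -- The total error is `390 = 260 + 65 + 65`.
  have h3 := h2 i
  have h4 := h2 j
  have h5 : Real.log 2 / (2 * 4 ^ 30) = Real.log 2 / 4 ^ 30 / 2 := by rw [div_div, mul_comm]
  rw [h5]
  generalize Real.log 2 / 4 ^ 30 = c at *
  have h6 : heightMatrix ĥ P i j / (c / 2) - pairingBits i j =
      (heightMatrix ĥ P i j * 2 - pairingBits i j * c) / c := by field_simp
  rw [h6, abs_div, abs_of_pos hc, div_le_iff₀ hc]
  simp only [heightMatrix, pairingBits, Matrix.of_apply]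
  push_cast
  rw [abs_le] at *
  constructor <;> linarith

end Bounds

/-! ### The determinant and its perturbation. -/

section Determinant

/-- The determinant of an integer matrix by Laplace expansion along the first row. -/
def laplaceDet : (n : ℕ) → (Fin n → Fin n → ℤ) → ℤ
  | 0, _ => 1
  | n + 1, A => ∑ j : Fin (n + 1), (-1) ^ (j : ℕ) * A 0 j *
      laplaceDet n fun a b ↦ A a.succ (j.succAbove b)

lemma det_eq_laplaceDet (n : ℕ) (A : Matrix (Fin n) (Fin n) ℤ) : A.det = laplaceDet n A := by
  induction n with
  | zero => simp [laplaceDet]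
  | succ n ih =>
    rw [Matrix.det_succ_row_zero]
    simp only [ih]
    rfl

lemma det_pairingBits : pairingBits.det =
    168944929925821789198332122817304014264946568540522947477986383282353446957310578258512915050210556380879406019245147387043492126107928 := by
  rw [det_eq_laplaceDet]
  decide +kernel

/-- Factors are exchanged one at a time. The extra factor `M` on the left avoids the exponent
`s.card - 1`. -/
lemma abs_prod_sub_prod_mul_le {ι : Type*} (s : Finset ι) {a b : ι → ℝ} {M ε : ℝ}
    (ha : ∀ i, |a i| ≤ M) (hb : ∀ i, |b i| ≤ M) (h : ∀ i, |a i - b i| ≤ ε) :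
    |∏ i ∈ s, a i - ∏ i ∈ s, b i| * M ≤ s.card * M ^ s.card * ε := by
  classical
  induction s using Finset.induction_on with
  | empty => simp
  | insert i s hi ih =>
    have hM : 0 ≤ M := (abs_nonneg _).trans (ha i)
    have hε : 0 ≤ ε := (abs_nonneg _).trans (h i)
    rw [Finset.prod_insert hi, Finset.prod_insert hi, Finset.card_insert_of_notMem hi]
    have h1 : |∏ j ∈ s, b j| ≤ M ^ s.card := by
      rw [Finset.abs_prod]
      exact (Finset.prod_le_prod (fun j _ ↦ abs_nonneg _) fun j _ ↦ hb j).trans_eq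
        (Finset.prod_const M)
    have h2 : a i * ∏ j ∈ s, a j - b i * ∏ j ∈ s, b j =
        a i * (∏ j ∈ s, a j - ∏ j ∈ s, b j) + (a i - b i) * ∏ j ∈ s, b j := by ring
    calc |a i * ∏ j ∈ s, a j - b i * ∏ j ∈ s, b j| * M
        ≤ (|a i| * |∏ j ∈ s, a j - ∏ j ∈ s, b j| + |a i - b i| * |∏ j ∈ s, b j|) * M := by
          rw [h2, ← abs_mul, ← abs_mul]
          gcongr
          exact abs_add_le _ _
      _ = |a i| * (|∏ j ∈ s, a j - ∏ j ∈ s, b j| * M) + |a i - b i| * |∏ j ∈ s, b j| * M := by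
          ring
      _ ≤ M * (s.card * M ^ s.card * ε) + ε * M ^ s.card * M := by
          gcongr
          exacts [ha i, h i]
      _ = (s.card + 1 : ℕ) * M ^ (s.card + 1) * ε := by push_cast; ring

/-- Perturbation of a determinant. -/
lemma abs_det_sub_det_mul_le {n : ℕ} {A B : Matrix (Fin n) (Fin n) ℝ} {M ε : ℝ} (hM : 0 ≤ M)
    (hA : ∀ i j, |A i j| ≤ M) (hB : ∀ i j, |B i j| ≤ M) (h : ∀ i j, |A i j - B i j| ≤ ε) :
    |A.det - B.det| * M ≤ n.factorial * (n * M ^ n * ε) := by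
  rw [Matrix.det_apply', Matrix.det_apply', ← Finset.sum_sub_distrib]
  calc _ ≤ (∑ σ : Equiv.Perm (Fin n), |∏ i, A (σ i) i - ∏ i, B (σ i) i|) * M := by
        gcongr
        refine (Finset.abs_sum_le_sum_abs _ _).trans (Finset.sum_le_sum fun σ _ ↦ ?_)
        rw [← mul_sub, abs_mul, ← Int.cast_abs]
        simp
    _ ≤ ∑ σ : Equiv.Perm (Fin n), (n * M ^ n * ε) := by
        rw [Finset.sum_mul]
        refine Finset.sum_le_sum fun σ _ ↦ ?_
        simpa using abs_prod_sub_prod_mul_le Finset.univ (fun i ↦ hA (σ i) i)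
          (fun i ↦ hB (σ i) i) fun i ↦ h (σ i) i
    _ = _ := by simp [Fintype.card_perm]

lemma abs_pairingBits_le :
    ∀ i j : Fin 7, |pairingBits i j| + 390 ≤ 60000000000000000000 := by
  decide +kernel

lemma abs_det_sub_lt {H : Matrix (Fin 7) (Fin 7) ℝ}
    (h : ∀ i j, |H i j / (Real.log 2 / (2 * 4 ^ 30)) - pairingBits i j| ≤ 390) :
    |H.det - 37472| < 1 := by
  have hl := Real.log_pos one_lt_two
  have hc : Real.log 2 / (2 * 4 ^ 30) ≠ 0 := by positivity
  set c := Real.log 2 / (2 * 4 ^ 30) with hc'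
  set R : Matrix (Fin 7) (Fin 7) ℝ := .of fun i j ↦ H i j / c with hR
  have hH : H = c • R := by
    ext i j
    simp only [hR, Matrix.smul_apply, Matrix.of_apply, smul_eq_mul]
    field_simp
  have hb : ∀ i j, |(pairingBits i j : ℝ)| + 390 ≤ 60000000000000000000 := fun i j ↦ by
    exact_mod_cast abs_pairingBits_le i j
  have key := abs_det_sub_det_mul_le (A := R) (B := pairingBits.map fun z : ℤ ↦ (z : ℝ))
    (M := 60000000000000000000) (by norm_num) (fun i j ↦ by
      have h1 := h i j
      have h2 := hb i j
      have h3 := abs_sub_abs_le_abs_sub (R i j) (pairingBits i j)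
      simp only [hR, Matrix.of_apply] at h3 ⊢
      linarith) (fun i j ↦ by
      have := hb i j
      simp only [Matrix.map_apply]
      linarith) h
  have hdet : (pairingBits.map fun z : ℤ ↦ (z : ℝ)).det = (pairingBits.det : ℤ) :=
    (Int.cast_det pairingBits).symm
  rw [hdet, det_pairingBits] at key
  have hN : Nat.factorial 7 = 5040 := rfl
  rw [hN] at key
  -- The perturbation bound `7! * 7 * M ^ 6 * 390`, divided by `(2 * 4 ^ 30) ^ 7`, is about `0.002`.
  have key2 : |R.det / (2 * 4 ^ 30) ^ 7 - 487457.789| ≤ 0.01 := by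
    rw [← le_div_iff₀ (by norm_num), abs_le] at key
    rw [abs_le, le_sub_iff_add_le, sub_le_iff_le_add, le_div_iff₀ (by positivity),
      div_le_iff₀ (by positivity)]
    push_cast at key
    norm_num at key ⊢
    constructor <;> linarith
  have hdetH : H.det = Real.log 2 ^ 7 * (R.det / (2 * 4 ^ 30) ^ 7) := by
    rw [hH, Matrix.det_smul, Fintype.card_fin, hc', div_pow]
    ring
  rw [hdetH]
  generalize R.det / (2 * 4 ^ 30) ^ 7 = r at key2
  -- Nine digits of `log 2` place the product near `37472.59`, inside the required interval.
  have h1 : (0.6931471803 : ℝ) ^ 7 ≤ Real.log 2 ^ 7 := by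
    gcongr
    exact Real.log_two_gt_d9.le
  have h2 : Real.log 2 ^ 7 ≤ (0.6931471808 : ℝ) ^ 7 := by
    gcongr
    exact Real.log_two_lt_d9.le
  generalize Real.log 2 ^ 7 = l at h1 h2
  rw [abs_le] at key2
  have h3 : (0.6931471803 : ℝ) ^ 7 * 487457.779 ≤ l * r := by
    gcongr
    linarith
  have h4 : l * r ≤ (0.6931471808 : ℝ) ^ 7 * 487457.799 := by
    gcongr <;> linarith
  rw [abs_lt]
  norm_num at h3 h4 ⊢
  constructor <;> linarith

end Determinant
end RankSeven

theorem mainTheorem4 [DecidableEq (RatFunc ℚ)] :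
    -- the seven points lie on the curve over `ℚ(T)`
    (∀ i, (RankSeven.points (RatFunc.X : RatFunc ℚ) i).2 ^ 2 =
      (RankSeven.quartic (RatFunc.X : RatFunc ℚ)).eval
        (RankSeven.points (RatFunc.X : RatFunc ℚ) i).1) ∧
    -- the cubic over `ℚ(T)` and its specialization at `T = 20` are elliptic curves
    (RankSeven.cubic (RatFunc.X : RatFunc ℚ)).IsElliptic ∧
    (RankSeven.cubic (20 : ℚ)).IsElliptic ∧
    -- after specialization at `T = 20` the transformed points are independent, with the
    -- stated determinant of the height matrix
    (∃ P : Fin 7 → (RankSeven.cubic (20 : ℚ)).toAffine.Point,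
      RankSeven.AreTransformed 20 P ∧ LinearIndependent ℤ P ∧
      ∃ ĥ : (RankSeven.cubic (20 : ℚ)).toAffine.Point → ℝ, RankSeven.IsCanonicalHeight ĥ ∧
        |(RankSeven.heightMatrix ĥ P).det - 37472| < 1) ∧
    -- the transformed points are independent over `ℚ(T)`, and the rank is at least `7`
    (∃ P : Fin 7 → (RankSeven.cubic (RatFunc.X : RatFunc ℚ)).toAffine.Point,
      RankSeven.AreTransformed RatFunc.X P ∧ LinearIndependent ℤ P) ∧
    7 ≤ Module.rank ℤ (RankSeven.cubic (RatFunc.X : RatFunc ℚ)).toAffine.Point := by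
  have hT := RankSeven.isElliptic_cubic (RankSeven.hasPadicEmbedding_ratFunc 17)
  have h20 := RankSeven.isElliptic_cubic (RankSeven.hasPadicEmbedding_rat 17)
  obtain ⟨P, hP, hP'⟩ := RankSeven.exists_areTransformed (20 : ℚ)
  obtain ⟨Q, hQ, hQ'⟩ := RankSeven.exists_areTransformed (RatFunc.X : RatFunc ℚ)
  obtain ⟨ĥ, hĥ, hb⟩ := RankSeven.exists_isCanonicalHeight
  have hQli := RankSeven.linearIndependent_points
    (fun p _ ↦ RankSeven.hasPadicEmbedding_ratFunc p) hQ'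
  refine ⟨RankSeven.point_mem_quartic _, hT, h20, ⟨P, hP, ?_, ĥ, hĥ, ?_⟩, ⟨Q, hQ, hQli⟩, ?_⟩
  · exact RankSeven.linearIndependent_points (fun p _ ↦ RankSeven.hasPadicEmbedding_rat p) hP'
  · refine RankSeven.abs_det_sub_lt (RankSeven.abs_heightMatrix_sub_le hĥ hb fun i ↦ ?_)
    rw [← RankSeven.pointX_twenty, ← RankSeven.pointY_twenty]
    exact hP' i
  · simpa using hQli.cardinal_le_rank
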